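/- Let $n\ge 3$, let $x_1<\dots<x_n$ be real numbers, let $\mu\in\mathbb{R}^n$ and $\sigma>0$. Let $y=\mu+\xi$ with $\xi\sim\mathcal N(0,\sigma^2 I_{n\times n})$, and write $\|u\|^2=\frac1n\sum_{i=1}^n u_i^2$ for $u\in\mathbb{R}^n$. Let $$\mathcal K=\{(f(x_1),\dots,f(x_n))^T : f:\mathbb{R}\to\mathbb{R}\text{ convex}\},$$ and for $u\in\mathcal K$ let $q(u)$ be the smallest integer $k$ for which there exist a partition $(T_1,\dots,T_k)$ of $\{1,\dots,n\}$ and real numbers $a_1,\dots,a_k$ such that $u_i=a_j(x_i-x_l)+u_l$ for all $i,l\in T_j$ and all $j=1,\dots,k$. Let $\hat\mu\in\operatorname{argmin}_{u\in\mathcal K}\|y-u\|^2$ be the least squares estimator over $\mathcal K$. Then for every $x>0$, with probability at least $1-e^{-x}$, $$\|\hat\mu-\mu\|^2\le\min_{u\in\mathcal K}\left(\|u-\mu\|^2+\frac{16\sigma^2 q(u)}{n}\log\frac{en}{q(u)}\right)+\frac{4\sigma^2x}{n},$$ where the minimum on the right-hand side is attained. -/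

import Mathlib

open MeasureTheory ProbabilityTheory

/-- The squared scaled norm `‖u‖² = (1/n) ∑ᵢ uᵢ²`. -/
noncomputable def scaledNormSq {n : ℕ} (u : EuclideanSpace ℝ (Fin n)) : ℝ :=
  (1 / (n : ℝ)) * ∑ i, (u i) ^ 2

/-- The cone of vectors `(f(x₁), …, f(xₙ))` with `f : ℝ → ℝ` convex. -/
def convexSeq {n : ℕ} (x : Fin n → ℝ) : Set (EuclideanSpace ℝ (Fin n)) :=
  {u | ∃ f : ℝ → ℝ, ConvexOn ℝ Set.univ f ∧ ∀ i, u i = f (x i)}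

/-- `u` is piecewise affine with `k` pieces with respect to the design points `x`: there is a
partition of the index set into `k` nonempty blocks on each of which `u` is affine in `x`. -/
def IsPiecewiseAffine {n : ℕ} (x : Fin n → ℝ) (u : EuclideanSpace ℝ (Fin n)) (k : ℕ) : Prop :=
  ∃ P : Finpartition (Finset.univ : Finset (Fin n)), P.parts.card = k ∧
    ∀ T ∈ P.parts, ∃ a : ℝ, ∀ i ∈ T, ∀ l ∈ T, u i = a * (x i - x l) + u l

/-- The smallest `k` such that `u` is piecewise affine with `k` pieces. -/
noncomputable def numPieces {n : ℕ} (x : Fin n → ℝ) (u : EuclideanSpace ℝ (Fin n)) : ℕ :=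
  sInf {k | IsPiecewiseAffine x u k}

/-- `v` is a least squares estimate over `K` for the observation `y`:
`v` minimizes `u ↦ ‖y - u‖²` over `K`. -/
def IsLeastSquares {n : ℕ} (K : Set (EuclideanSpace ℝ (Fin n)))
    (y v : EuclideanSpace ℝ (Fin n)) : Prop :=
  v ∈ K ∧ ∀ u ∈ K, scaledNormSq (y - v) ≤ scaledNormSq (y - u)

/-- Every vector is piecewise affine with `n` pieces, so `numPieces` is a genuine minimum. -/
theorem isPiecewiseAffine_numPieces {n : ℕ} (x : Fin n → ℝ) (u : EuclideanSpace ℝ (Fin n)) :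
    IsPiecewiseAffine x u (numPieces x u) ∧ numPieces x u ≤ n := by
  have h : n ∈ {k | IsPiecewiseAffine x u k} := by
    refine ⟨⊥, by simp, ?_⟩
    intro T hT
    rw [Finpartition.mem_bot_iff] at hT
    obtain ⟨j, -, rfl⟩ := hT
    refine ⟨0, ?_⟩
    intro i hi l hl
    rw [Finset.mem_singleton] at hi hl
    subst hi; subst hl; simp
  exact ⟨Nat.sInf_mem ⟨n, h⟩, Nat.sInf_le h⟩

theorem one_le_numPieces {n : ℕ} (hn : 0 < n) (x : Fin n → ℝ) (u : EuclideanSpace ℝ (Fin n)) :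
    1 ≤ numPieces x u := by
  obtain ⟨P, hP, -⟩ := (isPiecewiseAffine_numPieces x u).1
  rw [← hP, Nat.one_le_iff_ne_zero, Finset.card_ne_zero]
  exact P.parts_nonempty (by
    have : Nonempty (Fin n) := ⟨⟨0, hn⟩⟩
    simpa using Finset.univ_nonempty.ne_empty)

/-- The description of the cone by nondecreasing slopes. -/
theorem mem_convexSeq_iff {n : ℕ} (hn : 2 ≤ n) {x : Fin n → ℝ} (hx : StrictMono x)
    (u : EuclideanSpace ℝ (Fin n)) :
    u ∈ convexSeq x ↔ ∀ i j k : Fin n, (j : ℕ) = i + 1 → (k : ℕ) = j + 1 →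
      (u j - u i) / (x j - x i) ≤ (u k - u j) / (x k - x j) := by
  constructor
  · rintro ⟨f, hf, hu⟩ i j k hij hjk
    rw [hu i, hu j, hu k]
    exact hf.slope_mono_adjacent (Set.mem_univ _) (Set.mem_univ _)
      (hx (Fin.lt_def.2 (by omega))) (hx (Fin.lt_def.2 (by omega)))
  · intro h
    obtain ⟨m, rfl⟩ : ∃ m, n = m + 2 := ⟨n - 2, by omega⟩
    let s : Fin (m + 1) → ℝ := fun i =>
      (u i.succ - u i.castSucc) / (x i.succ - x i.castSucc)
    have hs : Monotone s := by
      refine Fin.monotone_iff_le_succ.2 fun i => ?_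
      exact h _ _ _ (by simp) (by simp)
    have hpos : ∀ i : Fin (m + 1), 0 < x i.succ - x i.castSucc := fun i =>
      sub_pos.2 (hx Fin.castSucc_lt_succ)
    have hstep : ∀ i : Fin (m + 1),
        u i.succ = u i.castSucc + s i * (x i.succ - x i.castSucc) := by
      intro i
      have := (hpos i).ne'
      simp only [s]
      field_simp
      ring
    have hup : ∀ (i : Fin (m + 1)) (j : Fin (m + 2)), i.castSucc ≤ j →
        u i.castSucc + s i * (x j - x i.castSucc) ≤ u j := by
      intro i j
      induction j using Fin.induction with
      | zero =>
        intro hij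
        have : i.castSucc = 0 := le_antisymm hij (Fin.zero_le _)
        simp [this]
      | succ j ih =>
        intro hij
        rcases hij.eq_or_lt with heq | hlt
        · simp [heq]
        · have hle : i ≤ j := Fin.castSucc_lt_succ_iff.1 hlt
          have h1 := ih (Fin.castSucc_le_castSucc_iff.2 hle)
          have h2 := mul_le_mul_of_nonneg_right (hs hle) (hpos j).le
          rw [hstep j]
          linarith
    have hdown : ∀ (i : Fin (m + 1)) (j : Fin (m + 2)), j ≤ i.succ →
        u i.castSucc + s i * (x j - x i.castSucc) ≤ u j := by
      intro i j
      induction j using Fin.reverseInduction with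
      | last =>
        intro hij
        have : i.succ = Fin.last _ := le_antisymm (Fin.le_last _) hij
        rw [← this, hstep i]
      | cast j ih =>
        intro hij
        rcases lt_or_ge i j with hlt | hle
        · have : j.castSucc = i.succ := le_antisymm hij (Fin.succ_le_castSucc_iff.2 hlt)
          rw [this, hstep i]
        · have h1 := ih (Fin.succ_le_succ_iff.2 hle)
          have h2 := mul_le_mul_of_nonneg_right (hs hle) (hpos j).le
          rw [hstep j] at h1
          linarith
    let f : ℝ → ℝ := fun t => Finset.univ.sup' Finset.univ_nonempty
      fun i : Fin (m + 1) => u i.castSucc + s i * (t - x i.castSucc)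
    refine ⟨f, ?_, ?_⟩
    · refine ⟨convex_univ, ?_⟩
      intro t _ r _ a b ha hb hab
      refine Finset.sup'_le _ _ fun i _ => ?_
      have ht := Finset.le_sup' (fun i : Fin (m + 1) => u i.castSucc + s i * (t - x i.castSucc))
        (Finset.mem_univ i)
      have hr := Finset.le_sup' (fun i : Fin (m + 1) => u i.castSucc + s i * (r - x i.castSucc))
        (Finset.mem_univ i)
      have h1 := mul_le_mul_of_nonneg_left ht ha
      have h2 := mul_le_mul_of_nonneg_left hr hb
      simp only [smul_eq_mul, f]
      refine le_trans (le_of_eq ?_) (add_le_add h1 h2)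
      obtain rfl : b = 1 - a := by linarith
      ring
    · intro j
      apply le_antisymm
      · induction j using Fin.lastCases with
        | last =>
          refine le_trans (le_of_eq ?_) (Finset.le_sup' _ (Finset.mem_univ (Fin.last m)))
          have := hstep (Fin.last m)
          rwa [Fin.succ_last] at this
        | cast j =>
          refine le_trans (le_of_eq ?_) (Finset.le_sup' _ (Finset.mem_univ j))
          simp
      · refine Finset.sup'_le _ _ fun i _ => ?_
        rcases le_total i.castSucc j with hij | hij
        · exact hup i j hij
        · exact hdown i j (hij.trans Fin.castSucc_lt_succ.le)

/-- A least squares estimate over the cone exists. -/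
theorem exists_isLeastSquares {n : ℕ} (hn : 2 ≤ n) {x : Fin n → ℝ} (hx : StrictMono x)
    (y : EuclideanSpace ℝ (Fin n)) : ∃ v, IsLeastSquares (convexSeq x) y v := by
  have hcl : IsClosed (convexSeq x) := by
    have : convexSeq x = {u | ∀ i j k : Fin n, (j : ℕ) = i + 1 → (k : ℕ) = j + 1 →
        (u j - u i) / (x j - x i) ≤ (u k - u j) / (x k - x j)} :=
      Set.ext fun u => mem_convexSeq_iff hn hx u
    rw [this]
    simp only [Set.ofPred_forall]
    refine isClosed_iInter fun i => isClosed_iInter fun j => isClosed_iInter fun k =>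
      isClosed_iInter fun _ => isClosed_iInter fun _ => isClosed_le ?_ ?_ <;> fun_prop
  obtain ⟨v, hv, hd⟩ := hcl.exists_infDist_eq_dist
    ⟨0, fun _ => 0, convexOn_const 0 convex_univ, fun i => by simp⟩ y
  refine ⟨v, hv, fun u hu => ?_⟩
  have h1 : dist y v ≤ dist y u := hd ▸ Metric.infDist_le_dist_of_mem hu
  have h2 : ∀ w : EuclideanSpace ℝ (Fin n), scaledNormSq w = (1 / (n : ℝ)) * ‖w‖ ^ 2 := by
    intro w
    rw [scaledNormSq, EuclideanSpace.real_norm_sq_eq]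
  rw [h2, h2, ← dist_eq_norm, ← dist_eq_norm]
  gcongr

/-! The basic inequality `IsLeastSquares.sum_sq_sub_le` bounds the excess loss over a competitor `u`
by the sum of `2ξᵢhᵢ - hᵢ²`, where `h = μhat - u`. On a block where `u` is affine, `h` samples a
convex function, hence decreases and then increases. For a fixed turning point the block's sum is at
most the sum of the squared norms of two isotonic regressions of the noise; adding exponentials over
all turning points covers the random one (`exp_block_le_unimodalWeight`). Distinct blocks use
independent coordinates, so exponential moments multiply, and Markov's inequality produces the `t`
term.

The crux is `isoMoment_le`: for standard Gaussian `z` in dimension `m`, the moment `M_m = E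
exp(‖isoReg z‖² / 4)` is at most `m + 1`. The level sets of `isoReg z` are runs of consecutive
indices; on each, the regression equals the mean of `z`, and deleting one leaves the regression of
the rest unchanged. Counting a level set of length `b` with weight `b` writes `m exp(‖isoReg z‖² /
4)` as a sum over runs. A run can be a level set only if its centred suffix sums are nonpositive.
Almost surely at most one of its `b` cyclic shifts has this property, which costs a factor `1/b` and
cancels the weight. The run's mean contributes `√2 ≤ 2`, and its position is determined by its mean
and the remaining data. Hence `m M_m ≤ 2 ∑_{j<m} M_j`, which `m + 1` solves with equality.

A block of size `k` therefore costs at most `k(k+1)² ≤ (ek)⁴`, and concavity of the logarithm gives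
`exp(4q log(en/q))` for `q` blocks. The division by 4 in the exponent turns 4 into 16 and `t` into
`4t`. The minimum is attained because there are only finitely many partitions. -/

/-! ### Isotonic regression as a cone projection -/

/-- `w` is the isotonic regression of `z`: the projection of `z` onto the cone of monotone vectors,
described by its optimality conditions. -/
def IsIsotonicReg {ι : Type*} [Fintype ι] [LinearOrder ι] (z w : ι → ℝ) : Prop :=
  Monotone w ∧ (∀ v : ι → ℝ, Monotone v → ∑ i, (z i - w i) * v i ≤ 0) ∧
    ∑ i, (z i - w i) * w i = 0

section Isotonic

variable {ι κ : Type*} [Fintype ι] [LinearOrder ι] [Fintype κ] [LinearOrder κ]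

theorem exists_isIsotonicReg (z : ι → ℝ) : ∃ w, IsIsotonicReg z w := by
  let C : Set (EuclideanSpace ℝ ι) := {v | Monotone v}
  have hC : C = {v | ∀ i j, i ≤ j → v i ≤ v j} := rfl
  have hcl : IsClosed C := by
    rw [hC]
    simp only [Set.ofPred_forall]
    refine isClosed_iInter fun i => isClosed_iInter fun j => isClosed_iInter fun _ =>
      isClosed_le ?_ ?_ <;> fun_prop
  have hconv : Convex ℝ C := by
    intro v hv w hw a b ha hb _ i j hij
    exact add_le_add (mul_le_mul_of_nonneg_left (hv hij) ha)
      (mul_le_mul_of_nonneg_left (hw hij) hb)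
  obtain ⟨w, hw, hmin⟩ := exists_norm_eq_iInf_of_complete_convex
    (⟨0, fun _ _ _ => le_rfl⟩ : C.Nonempty) hcl.isComplete hconv (WithLp.toLp 2 z)
  have hineq := (norm_eq_iInf_iff_real_inner_le_zero hconv hw).1 hmin
  have key : ∀ v : ι → ℝ, Monotone v → ∑ i, (z i - w i) * (v i - w i) ≤ 0 := by
    intro v hv
    have := hineq (WithLp.toLp 2 v) hv
    simpa [PiLp.inner_apply, mul_comm] using this
  -- The cone contains `0` and `2w`; testing both gives the two signs of the orthogonality relation.
  have h0 := key 0 fun _ _ _ => le_rfl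
  have h2 := key (fun i => w i + w i) fun i j h => add_le_add (hw h) (hw h)
  have horth : ∑ i, (z i - w i) * w i = 0 := by
    simp only [Pi.zero_apply, zero_sub, mul_neg, Finset.sum_neg_distrib, add_sub_cancel_right]
      at h0 h2
    linarith
  refine ⟨w, hw, fun v hv => ?_, horth⟩
  have := key v hv
  simp only [mul_sub, Finset.sum_sub_distrib] at this horth ⊢
  linarith

/-- Isotonic regression of a vector indexed by a finite linear order. -/
noncomputable def isoReg (z : ι → ℝ) : ι → ℝ := (exists_isIsotonicReg z).choose

theorem isIsotonicReg_isoReg (z : ι → ℝ) : IsIsotonicReg z (isoReg z) :=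
  (exists_isIsotonicReg z).choose_spec

/-- Projections are nonexpansive; uniqueness and continuity, hence measurability, of `isoReg`
follow. -/
theorem IsIsotonicReg.sum_sq_sub_le {z₁ z₂ w₁ w₂ : ι → ℝ} (h₁ : IsIsotonicReg z₁ w₁)
    (h₂ : IsIsotonicReg z₂ w₂) :
    ∑ i, (w₁ i - w₂ i) ^ 2 ≤ ∑ i, (z₁ i - z₂ i) ^ 2 := by
  have e1 := h₁.2.1 w₂ h₂.1
  have e2 := h₂.2.1 w₁ h₁.1
  have e3 := h₁.2.2
  have e4 := h₂.2.2
  have e5 : 0 ≤ ∑ i, ((z₁ i - z₂ i) - (w₁ i - w₂ i)) ^ 2 :=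
    Finset.sum_nonneg fun i _ => sq_nonneg _
  have e6 : ∑ i, (z₁ i - z₂ i) ^ 2 - ∑ i, (w₁ i - w₂ i) ^ 2 =
      ∑ i, ((z₁ i - z₂ i) - (w₁ i - w₂ i)) ^ 2 +
      2 * (∑ i, (z₁ i - w₁ i) * w₁ i + ∑ i, (z₂ i - w₂ i) * w₂ i
        - ∑ i, (z₁ i - w₁ i) * w₂ i - ∑ i, (z₂ i - w₂ i) * w₁ i) := by
    simp only [← Finset.sum_sub_distrib, ← Finset.sum_add_distrib, Finset.mul_sum]
    exact Finset.sum_congr rfl fun i _ => by ring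
  linarith

theorem IsIsotonicReg.eq_isoReg {z w : ι → ℝ} (h : IsIsotonicReg z w) : w = isoReg z := by
  have h1 := h.sum_sq_sub_le (isIsotonicReg_isoReg z)
  simp only [sub_self, ne_eq, OfNat.ofNat_ne_zero, not_false_eq_true, zero_pow,
    Finset.sum_const_zero] at h1
  funext i
  have h2 := (Finset.sum_eq_zero_iff_of_nonneg (fun i _ => sq_nonneg (w i - isoReg z i))).1
    (le_antisymm h1 (Finset.sum_nonneg fun i _ => sq_nonneg _)) i (Finset.mem_univ i)
  exact sub_eq_zero.1 (pow_eq_zero_iff two_ne_zero |>.1 h2)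

theorem isoReg_comp_orderIso (e : κ ≃o ι) (z : ι → ℝ) : isoReg (z ∘ e) = isoReg z ∘ e := by
  symm
  have h := isIsotonicReg_isoReg z
  refine IsIsotonicReg.eq_isoReg ⟨h.1.comp e.monotone, fun v hv => ?_, ?_⟩
  · have := h.2.1 (v ∘ e.symm) (hv.comp e.symm.monotone)
    rw [← e.toEquiv.sum_comp] at this
    simpa using this
  · have := h.2.2
    rw [← e.toEquiv.sum_comp] at this
    simpa using this

theorem continuous_isoReg : Continuous (isoReg : (ι → ℝ) → ι → ℝ) := by
  refine continuous_pi fun i => continuous_iff_continuousAt.2 fun z₀ => ?_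
  have hle : ∀ z : ι → ℝ, ‖isoReg z i - isoReg z₀ i‖ ≤ √(∑ j, (z j - z₀ j) ^ 2) := by
    intro z
    refine Real.le_sqrt_of_sq_le ?_
    rw [Real.norm_eq_abs, sq_abs]
    exact (Finset.single_le_sum (f := fun j => (isoReg z j - isoReg z₀ j) ^ 2)
      (fun j _ => sq_nonneg _) (Finset.mem_univ i)).trans
      ((isIsotonicReg_isoReg z).sum_sq_sub_le (isIsotonicReg_isoReg z₀))
  refine tendsto_iff_norm_sub_tendsto_zero.2 (squeeze_zero (fun _ => norm_nonneg _) hle ?_)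
  have hc : Continuous fun z : ι → ℝ => √(∑ j, (z j - z₀ j) ^ 2) := by fun_prop
  simpa using hc.tendsto z₀

/-- The squared norm of the isotonic regression. -/
noncomputable def isoSq (z : ι → ℝ) : ℝ := ∑ i, isoReg z i ^ 2

theorem continuous_isoSq : Continuous (isoSq : (ι → ℝ) → ℝ) := by
  have := continuous_isoReg (ι := ι)
  unfold isoSq
  fun_prop

theorem isoSq_comp_orderIso (e : κ ≃o ι) (z : ι → ℝ) : isoSq (z ∘ e) = isoSq z := by
  simp only [isoSq, isoReg_comp_orderIso]
  exact e.toEquiv.sum_comp fun i => isoReg z i ^ 2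

/-- The functional `2⟨z, v⟩ - ‖v‖²` is maximised over the cone by the projection, with value its
squared norm. -/
theorem sum_le_isoSq (z : ι → ℝ) {v : ι → ℝ} (hv : Monotone v) :
    ∑ i, (2 * z i * v i - v i ^ 2) ≤ isoSq z := by
  have h1 := (isIsotonicReg_isoReg z).2.1 v hv
  have h2 : 0 ≤ ∑ i, (isoReg z i - v i) ^ 2 := Finset.sum_nonneg fun i _ => sq_nonneg _
  have h3 : isoSq z - ∑ i, (2 * z i * v i - v i ^ 2) =
      ∑ i, (isoReg z i - v i) ^ 2 - 2 * ∑ i, (z i - isoReg z i) * v i := by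
    simp only [isoSq, ← Finset.sum_sub_distrib, Finset.mul_sum]
    exact Finset.sum_congr rfl fun i _ => by ring
  linarith

/-- The optimality condition may be tested on vectors that are monotone on the level sets only. -/
theorem IsIsotonicReg.sum_le_zero {z w φ : ι → ℝ} (h : IsIsotonicReg z w)
    (hφ : ∀ i j, i ≤ j → w i = w j → φ i ≤ φ j) : ∑ i, (z i - w i) * φ i ≤ 0 := by
  -- For small `ε > 0`, `w + εφ` is monotone: strict gaps of `w` survive by continuity, ties are
  -- handled by `hφ`.
  have hev : ∀ᶠ ε in nhdsWithin (0 : ℝ) (Set.Ioi 0), ∀ i j, i ≤ j →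
      w i + ε * φ i ≤ w j + ε * φ j := by
    refine Filter.eventually_all.2 fun i => Filter.eventually_all.2 fun j => ?_
    by_cases hij : i ≤ j
    · rcases (h.1 hij).eq_or_lt with heq | hlt
      · filter_upwards [self_mem_nhdsWithin] with ε hε _
        rw [heq]
        have := mul_le_mul_of_nonneg_left (hφ i j hij heq) (le_of_lt hε)
        linarith
      · have hc : ContinuousAt (fun ε : ℝ => w j + ε * φ j - (w i + ε * φ i)) 0 := by fun_prop
        have := hc.eventually (lt_mem_nhds (a := 0) (by simpa using hlt))
        filter_upwards [nhdsWithin_le_nhds this] with ε hε _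
        linarith
    · exact Filter.Eventually.of_forall fun ε h' => absurd h' hij
  obtain ⟨ε, hε, hpos⟩ := (hev.and self_mem_nhdsWithin).exists
  have h1 := h.2.1 (fun i => w i + ε * φ i) fun i j hij => hε i j hij
  have h2 := h.2.2
  simp only [mul_add, Finset.sum_add_distrib, h2, zero_add, mul_left_comm _ ε,
    ← Finset.mul_sum] at h1
  exact nonpos_of_mul_nonpos_right h1 hpos

end Isotonic

/-! ### Level sets of the isotonic regression -/

/-- The arithmetic mean of a finite family. -/
noncomputable def mean {κ : Type*} [Fintype κ] (x : κ → ℝ) : ℝ := (∑ i, x i) / Fintype.card κ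

/-- All suffix sums of the centred family are nonpositive. -/
def IsBridge {κ : Type*} [Fintype κ] [LinearOrder κ] (x : κ → ℝ) : Prop :=
  ∀ j, ∑ k, (if j ≤ k then x k - mean x else 0) ≤ 0

section Block

variable {ι : Type*} [Fintype ι] [LinearOrder ι]

variable {z : ι → ℝ} {c : ℝ} {p : ι → Prop} [DecidablePred p]

/-- Both signs of the level set's indicator are admissible test vectors, being constant on every
level set. -/
theorem sum_levelSet_eq_zero (hp : ∀ i, p i ↔ isoReg z i = c) :
    ∑ i : {i // p i}, (z i - c) = 0 := by
  have hz := isIsotonicReg_isoReg z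
  have key : ∀ s : ℝ, ∑ i, (z i - isoReg z i) * (if p i then s else 0) =
      s * ∑ i : {i // p i}, (z i - c) := by
    intro s
    rw [← Fintype.sum_subtype_add_sum_subtype p, Finset.mul_sum, Finset.sum_eq_zero (s := (Finset.univ :
      Finset {i // ¬ p i})) fun i _ => by rw [if_neg i.2, mul_zero], add_zero]
    refine Finset.sum_congr rfl fun i _ => ?_
    rw [if_pos i.2, (hp i).1 i.2, mul_comm]
  have h : ∀ s : ℝ, ∑ i, (z i - isoReg z i) * (if p i then s else 0) ≤ 0 := by
    refine fun s => hz.sum_le_zero fun i j _ hw => ?_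
    have : p i ↔ p j := by rw [hp, hp, hw]
    simp [this]
  have h1 := h 1
  have h2 := h (-1)
  rw [key] at h1 h2
  linarith

theorem mean_levelSet (hp : ∀ i, p i ↔ isoReg z i = c) [Nonempty {i // p i}] :
    mean (fun i : {i // p i} => z i) = c := by
  have h := sum_levelSet_eq_zero hp
  rw [Finset.sum_sub_distrib, Finset.sum_const, Finset.card_univ, nsmul_eq_mul] at h
  have : (Fintype.card {i // p i} : ℝ) ≠ 0 := Nat.cast_ne_zero.2 Fintype.card_ne_zero
  rw [mean, sub_eq_zero.1 h, mul_div_cancel_left₀ _ this]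

theorem isBridge_levelSet (hp : ∀ i, p i ↔ isoReg z i = c) [Nonempty {i // p i}] :
    IsBridge (fun i : {i // p i} => z i) := by
  intro j
  rw [mean_levelSet hp]
  have hz := isIsotonicReg_isoReg z
  -- The indicator of the upper part of the level set is monotone within each level set, hence
  -- admissible.
  have h : ∑ i, (z i - isoReg z i) * (if p i ∧ j.1 ≤ i then 1 else 0) ≤ 0 := by
    refine hz.sum_le_zero fun i k hik hw => ?_
    have : p i ↔ p k := by rw [hp, hp, hw]
    by_cases h1 : p i ∧ j.1 ≤ i
    · rw [if_pos h1, if_pos ⟨this.1 h1.1, h1.2.trans hik⟩]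
    · rw [if_neg h1]
      split_ifs <;> norm_num
  rw [← Fintype.sum_subtype_add_sum_subtype p, Finset.sum_eq_zero (s := (Finset.univ :
      Finset {i // ¬ p i})) fun i _ => by rw [if_neg fun h => i.2 h.1, mul_zero], add_zero] at h
  refine le_trans (le_of_eq (Finset.sum_congr rfl fun i _ => ?_)) h
  have h1 : (j ≤ i) ↔ (p i ∧ j.1 ≤ i) := ⟨fun h => ⟨i.2, h⟩, fun h => h.2⟩
  simp only [h1, (hp i).1 i.2, mul_ite, mul_one, mul_zero]

/-- A test vector on the complement, extended by zero to the level set, is still monotone on each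
level set, so the optimality conditions pass to the restriction. -/
theorem isoReg_compl_levelSet (hp : ∀ i, p i ↔ isoReg z i = c) :
    isoReg (fun i : {i // ¬ p i} => z i) = fun i : {i // ¬ p i} => isoReg z i := by
  have hz := isIsotonicReg_isoReg z
  symm
  refine IsIsotonicReg.eq_isoReg ⟨fun i j h => hz.1 h, fun v hv => ?_, ?_⟩
  · have h : ∑ i, (z i - isoReg z i) * (if h : p i then 0 else v ⟨i, h⟩) ≤ 0 := by
      refine hz.sum_le_zero fun i k hik hw => ?_
      have : p i ↔ p k := by rw [hp, hp, hw]
      by_cases h1 : p i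
      · rw [dif_pos h1, dif_pos (this.1 h1)]
      · rw [dif_neg h1, dif_neg fun h2 => h1 (this.2 h2)]
        exact hv hik
    rw [← Fintype.sum_subtype_add_sum_subtype p, Finset.sum_eq_zero (s := (Finset.univ :
      Finset {i // p i})) fun i _ => by rw [dif_pos i.2, mul_zero], zero_add] at h
    refine le_trans (le_of_eq (Finset.sum_congr rfl fun i _ => ?_)) h
    rw [dif_neg i.2]
  · have h := hz.2.2
    have h0 : ∑ i : {i // p i}, (z i - isoReg z i) * isoReg z i = 0 := by
      have := congrArg (· * c) (sum_levelSet_eq_zero hp)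
      simp only [Finset.sum_mul, zero_mul] at this
      rw [← this]
      exact Finset.sum_congr rfl fun i _ => by rw [(hp i).1 i.2]
    rwa [← Fintype.sum_subtype_add_sum_subtype p, h0, zero_add] at h

theorem isoSq_eq_levelSet (hp : ∀ i, p i ↔ isoReg z i = c) :
    isoSq z = Fintype.card {i // p i} * c ^ 2 + isoSq (fun i : {i // ¬ p i} => z i) := by
  rw [isoSq, isoSq, isoReg_compl_levelSet hp, ← Fintype.sum_subtype_add_sum_subtype p]
  congr 1
  rw [Finset.sum_congr rfl fun i _ => by rw [(hp i.1).1 i.2], Finset.sum_const, Finset.card_univ,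
    nsmul_eq_mul]

/-- The position of the deleted block can thus be read off from its mean and the remaining data,
which later makes the sum over positions collapse. -/
theorem card_compl_levelSet_lt (hp : ∀ i, p i ↔ isoReg z i = c) :
    Fintype.card {i : {i // ¬ p i} // isoReg (fun i : {i // ¬ p i} => z i) i < c} =
      Fintype.card {i // isoReg z i < c} := by
  rw [isoReg_compl_levelSet hp]
  exact Fintype.card_congr ⟨fun i => ⟨i.1.1, i.2⟩,
    fun i => ⟨⟨i.1, fun h => i.2.ne ((hp _).1 h)⟩, i.2⟩, fun _ => rfl, fun _ => rfl⟩

end Block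

/-- Position, length, mean and bridge condition of a block of length `|κ|` inserted at position `a`
into a vector indexed by `κ'`, weighted by the exponential of the squared norm. -/
noncomputable def blockWeight {κ κ' : Type*} [Fintype κ] [LinearOrder κ] [Fintype κ']
    [LinearOrder κ'] (a : ℕ) (x : κ → ℝ) (y : κ' → ℝ) : ENNReal :=
  open Classical in
  (if IsBridge x then 1 else 0) *
    (if Fintype.card {i // isoReg y i < mean x} = a then 1 else 0) *
    (ENNReal.ofReal (Real.exp (Fintype.card κ * mean x ^ 2 / 4)) *
      ENNReal.ofReal (Real.exp (isoSq y / 4)))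

theorem lt_card_subtype_iff {m : ℕ} (P : Fin m → Prop) [DecidablePred P]
    (hP : ∀ k l, k ≤ l → P l → P k) (k : Fin m) : P k ↔ (k : ℕ) < Fintype.card {k // P k} := by
  rw [Fintype.card_subtype]
  constructor
  · intro hk
    have : Finset.Iic k ⊆ Finset.univ.filter fun x => P x := by
      intro l hl
      simpa using hP l k (Finset.mem_Iic.1 hl) hk
    have := Finset.card_le_card this
    rw [Fin.card_Iic] at this
    omega
  · intro hk
    by_contra hPk
    have : (Finset.univ.filter fun x => P x) ⊆ Finset.Iio k := by
      intro l hl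
      rw [Finset.mem_Iio]
      by_contra hlk
      exact hPk (hP k l (not_lt.1 hlk) (by simpa using hl))
    have := Finset.card_le_card this
    rw [Fin.card_Iio] at this
    omega

/-- The block is the level set of `isoReg z` through `i`, an interval by monotonicity; both
indicators in `blockWeight` then equal one. -/
theorem exists_block {m : ℕ} (z : Fin m → ℝ) (i : Fin m) :
    ∃ a b : ℕ, (a ≤ i ∧ i < a + b) ∧ a + b ≤ m ∧
      blockWeight a (fun k : {k : Fin m // a ≤ k ∧ k < a + b} => z k)
        (fun k : {k : Fin m // ¬ (a ≤ k ∧ k < a + b)} => z k) =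
        ENNReal.ofReal (Real.exp (isoSq z / 4)) := by
  set w := isoReg z with hw
  have hmono : Monotone w := (isIsotonicReg_isoReg z).1
  set c := w i
  set a := Fintype.card {k // w k < c} with ha
  set d := Fintype.card {k // w k ≤ c} with hd
  have hA := lt_card_subtype_iff (fun k => w k < c) fun k l hkl h => (hmono hkl).trans_lt h
  have hD := lt_card_subtype_iff (fun k => w k ≤ c) fun k l hkl h => (hmono hkl).trans h
  have had : a ≤ d := Fintype.card_subtype_mono _ _ fun k (hk : w k < c) => hk.le
  have hdm : d ≤ m := by
    have := Fintype.card_subtype_le fun k => w k ≤ c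
    rwa [Fintype.card_fin] at this
  have hp : ∀ k : Fin m, (a ≤ k ∧ k < a + (d - a)) ↔ isoReg z k = c := by
    intro k
    rw [Nat.add_sub_cancel' had, ← not_lt, ← hA k, ← hD k, not_lt, ← hw]
    exact ⟨fun h => le_antisymm h.2 h.1, fun h => ⟨h.ge, h.le⟩⟩
  refine ⟨a, d - a, (hp i).2 rfl, by omega, ?_⟩
  have : Nonempty {k : Fin m // a ≤ k ∧ k < a + (d - a)} := ⟨⟨i, (hp i).2 rfl⟩⟩
  have h1 := mean_levelSet hp
  have h2 := isBridge_levelSet hp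
  have h3 := isoSq_eq_levelSet hp
  have h4 := card_compl_levelSet_lt hp
  rw [blockWeight, if_pos h2, h1, if_pos (h4.trans ha.symm), one_mul, one_mul,
    ← ENNReal.ofReal_mul (Real.exp_nonneg _), ← Real.exp_add, h3, add_div]

/-! ### Gaussian integrals of block weights -/

/-- The standard Gaussian measure on `ι → ℝ`. -/
noncomputable def gaussPi (ι : Type*) [Fintype ι] : Measure (ι → ℝ) :=
  Measure.pi fun _ => gaussianReal 0 1

instance {ι : Type*} [Fintype ι] : IsProbabilityMeasure (gaussPi ι) := by
  unfold gaussPi; infer_instance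

theorem measurePreserving_gaussPi_comp {ι κ : Type*} [Fintype ι] [Fintype κ] (e : κ ≃ ι) :
    MeasurePreserving (fun z : ι → ℝ => z ∘ e) (gaussPi ι) (gaussPi κ) :=
  (measurePreserving_piCongrLeft (fun _ : ι => gaussianReal 0 1) e).symm

theorem lintegral_gaussPi_comp {ι κ : Type*} [Fintype ι] [Fintype κ] (e : κ ≃ ι)
    (f : (κ → ℝ) → ENNReal) :
    ∫⁻ z, f (z ∘ e) ∂gaussPi ι = ∫⁻ z, f z ∂gaussPi κ :=
  (measurePreserving_piCongrLeft (fun _ : ι => gaussianReal 0 1) e).symm.lintegral_comp_emb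
    (MeasurableEquiv.measurableEmbedding _) f

theorem lintegral_gaussPi_subtype {ι : Type*} [Fintype ι] (p : ι → Prop) [DecidablePred p]
    (f : ({i // p i} → ℝ) → ({i // ¬ p i} → ℝ) → ENNReal) :
    ∫⁻ z, f (fun i => z i) (fun i => z i) ∂gaussPi ι =
      ∫⁻ q, f q.1 q.2 ∂(gaussPi {i // p i}).prod (gaussPi {i // ¬ p i}) :=
  (measurePreserving_piEquivPiSubtypeProd (fun _ : ι => gaussianReal 0 1) p).lintegral_comp_emb
    (MeasurableEquiv.measurableEmbedding _) fun q => f q.1 q.2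

theorem measurable_mean {κ : Type*} [Fintype κ] : Measurable (mean : (κ → ℝ) → ℝ) := by
  unfold mean; fun_prop

theorem mean_comp_equiv {κ ι : Type*} [Fintype κ] [Fintype ι] (e : κ ≃ ι) (x : ι → ℝ) :
    mean (x ∘ e) = mean x := by
  rw [mean, mean, Fintype.card_congr e]
  exact congrArg (· / _) (e.sum_comp x)

section

variable {κ κ' ι ι' : Type*} [Fintype κ] [LinearOrder κ] [Fintype κ'] [LinearOrder κ']
  [Fintype ι] [LinearOrder ι] [Fintype ι'] [LinearOrder ι']

theorem isBridge_comp_orderIso (e : κ ≃o ι) (x : ι → ℝ) : IsBridge (x ∘ e) ↔ IsBridge x := by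
  unfold IsBridge
  rw [show mean (x ∘ e) = mean x from mean_comp_equiv e.toEquiv x, ← e.toEquiv.forall_congr_right]
  refine forall_congr' fun j => ?_
  rw [← e.toEquiv.sum_comp]
  simp

theorem measurableSet_isBridge : MeasurableSet {x : κ → ℝ | IsBridge x} := by
  have := measurable_mean (κ := κ)
  unfold IsBridge
  simp only [Set.ofPred_forall]
  refine MeasurableSet.iInter fun j => measurableSet_le (Finset.measurable_sum _ fun k _ => ?_)
    measurable_const
  split_ifs <;> fun_prop

theorem measurable_blockWeight (a : ℕ) :
    Measurable fun q : (κ → ℝ) × (κ' → ℝ) => blockWeight a q.1 q.2 := by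
  classical
  have h1 := measurable_mean (κ := κ)
  have h2 := (continuous_isoReg (ι := κ')).measurable
  have h3 := (continuous_isoSq (ι := κ')).measurable
  unfold blockWeight
  refine (Measurable.mul ?_ ?_).mul (by fun_prop)
  · exact Measurable.ite (measurableSet_isBridge.preimage measurable_fst) measurable_const
      measurable_const
  · refine Measurable.ite ?_ measurable_const measurable_const
    simp only [Fintype.card_subtype, Finset.card_filter]
    refine measurableSet_eq_fun (Finset.measurable_sum _ fun i _ => ?_) measurable_const
    exact Measurable.ite (measurableSet_lt (by fun_prop) (by fun_prop)) measurable_const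
      measurable_const

theorem blockWeight_comp_orderIso (a : ℕ) (e : κ ≃o ι) (e' : κ' ≃o ι') (x : ι → ℝ) (y : ι' → ℝ) :
    blockWeight a (x ∘ e) (y ∘ e') = blockWeight a x y := by
  classical
  unfold blockWeight
  rw [isoReg_comp_orderIso, isoSq_comp_orderIso,
    show mean (x ∘ e) = mean x from mean_comp_equiv e.toEquiv x, Fintype.card_congr e.toEquiv]
  have : Fintype.card {i // (isoReg y ∘ e') i < mean x} = Fintype.card {i // isoReg y i < mean x} :=
    Fintype.card_congr (e'.toEquiv.subtypeEquiv fun _ => Iff.rfl)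
  rw [this]
  simp only [isBridge_comp_orderIso]

theorem lintegral_blockWeight_congr (a : ℕ) (h : Fintype.card κ = Fintype.card ι)
    (h' : Fintype.card κ' = Fintype.card ι') :
    ∫⁻ q, blockWeight a q.1 q.2 ∂(gaussPi κ).prod (gaussPi κ') =
      ∫⁻ q, blockWeight a q.1 q.2 ∂(gaussPi ι).prod (gaussPi ι') := by
  let e : κ ≃o ι := (Fintype.orderIsoFinOfCardEq κ h).symm.trans (Fintype.orderIsoFinOfCardEq ι rfl)
  let e' : κ' ≃o ι' :=
    (Fintype.orderIsoFinOfCardEq κ' h').symm.trans (Fintype.orderIsoFinOfCardEq ι' rfl)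
  rw [← ((measurePreserving_gaussPi_comp e.toEquiv).prod
    (measurePreserving_gaussPi_comp e'.toEquiv)).lintegral_comp (measurable_blockWeight a)]
  exact lintegral_congr fun q => blockWeight_comp_orderIso a e e' q.1 q.2

/-- For given `x` and `y` at most one position `a` is compatible, so summing over positions costs
nothing. -/
theorem sum_blockWeight_le (s : Finset ℕ) (x : κ → ℝ) (y : κ' → ℝ) :
    ∑ a ∈ s, blockWeight a x y ≤
      (open Classical in (if IsBridge x then 1 else 0) *
        ENNReal.ofReal (Real.exp (Fintype.card κ * mean x ^ 2 / 4))) *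
        ENNReal.ofReal (Real.exp (isoSq y / 4)) := by
  classical
  unfold blockWeight
  rw [← Finset.sum_mul, ← Finset.mul_sum, mul_assoc (if IsBridge x then (1 : ENNReal) else 0)
    (ENNReal.ofReal _)]
  refine mul_le_mul' (mul_le_of_le_one_right' ?_) le_rfl
  rw [Finset.sum_ite_eq]
  split_ifs <;> simp

/-- The exponential moment of the squared norm of the isotonic regression of Gaussian noise. -/
noncomputable def isoMoment (κ : Type*) [Fintype κ] [LinearOrder κ] : ENNReal :=
  ∫⁻ z : κ → ℝ, ENNReal.ofReal (Real.exp (isoSq z / 4)) ∂gaussPi κ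

theorem isoMoment_congr (h : Fintype.card κ = Fintype.card ι) : isoMoment κ = isoMoment ι := by
  let e : κ ≃o ι := (Fintype.orderIsoFinOfCardEq κ h).symm.trans (Fintype.orderIsoFinOfCardEq ι rfl)
  unfold isoMoment
  rw [← lintegral_gaussPi_comp e.toEquiv]
  exact lintegral_congr fun z => by
    rw [show isoSq (z ∘ e.toEquiv) = isoSq z from isoSq_comp_orderIso e z]

end

/-- Double counting: every index lies in a level set, and a level set of length `b` is selected by
at most `b` indices. -/
theorem exp_isoSq_le_sum_blockWeight {m : ℕ} (z : Fin m → ℝ) :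
    (m : ENNReal) * ENNReal.ofReal (Real.exp (isoSq z / 4)) ≤
      ∑ b ∈ Finset.Icc 1 m, ∑ a ∈ Finset.range (m - b + 1), (b : ENNReal) *
        blockWeight a (fun k : {k : Fin m // a ≤ k ∧ k < a + b} => z k)
          (fun k : {k : Fin m // ¬ (a ≤ k ∧ k < a + b)} => z k) := by
  classical
  choose A B hAB hm hw using exists_block z
  set X := ENNReal.ofReal (Real.exp (isoSq z / 4)) with hX
  rw [Finset.sum_sigma' (Finset.Icc 1 m) (fun b => Finset.range (m - b + 1))]
  set S := (Finset.Icc 1 m).sigma fun b => Finset.range (m - b + 1) with hS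
  have hmaps : ∀ i ∈ (Finset.univ : Finset (Fin m)), (⟨B i, A i⟩ : Σ _ : ℕ, ℕ) ∈ S := by
    intro i _
    have h1 := hAB i
    have h2 := hm i
    simp only [hS, Finset.mem_sigma, Finset.mem_Icc, Finset.mem_range]
    omega
  have hcard := Finset.card_eq_sum_card_fiberwise hmaps
  rw [Finset.card_univ, Fintype.card_fin] at hcard
  conv_lhs => rw [hcard]
  rw [Nat.cast_sum, Finset.sum_mul]
  refine Finset.sum_le_sum fun q hq => ?_
  -- A pair chosen by no index contributes zero on the left; otherwise its fibre lies in `[a, a +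
  -- b)`.
  rcases (Finset.univ.filter fun i => (⟨B i, A i⟩ : Σ _ : ℕ, ℕ) = q).eq_empty_or_nonempty
    with h0 | ⟨i, hi⟩
  · rw [h0]; simp
  · have hi' : (⟨B i, A i⟩ : Σ _ : ℕ, ℕ) = q := by simpa using hi
    have hle : (Finset.univ.filter fun i => (⟨B i, A i⟩ : Σ _ : ℕ, ℕ) = q).card ≤ q.1 := by
      have : ((Finset.univ.filter fun i => (⟨B i, A i⟩ : Σ _ : ℕ, ℕ) = q).map
          Fin.valEmbedding) ⊆ Finset.Ico q.2 (q.2 + q.1) := by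
        intro k hk
        obtain ⟨l, hl, rfl⟩ := Finset.mem_map.1 hk
        have hl' : (⟨B l, A l⟩ : Σ _ : ℕ, ℕ) = q := by simpa using hl
        rw [← hl']
        exact Finset.mem_Ico.2 (hAB l)
      have := Finset.card_le_card this
      rwa [Finset.card_map, Nat.card_Ico, Nat.add_sub_cancel_left] at this
    subst hi'
    rw [hw i]
    exact mul_le_mul' (by exact_mod_cast hle) le_rfl

theorem map_gaussPi_linear {κ : Type*} [Fintype κ] (a : κ → ℝ) :
    (gaussPi κ).map (fun x => ∑ i, a i * x i) = gaussianReal 0 (∑ i, a i ^ 2).toNNReal := by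
  let L : StrongDual ℝ (EuclideanSpace ℝ κ) := innerSL ℝ (WithLp.toLp 2 a)
  have hL : (fun x : κ → ℝ => ∑ i, a i * x i) = L ∘ WithLp.toLp 2 := by
    funext x
    simp [L, PiLp.inner_apply, mul_comm]
  have hn : ‖L‖ ^ 2 = ∑ i, a i ^ 2 := by
    simp [L, EuclideanSpace.real_norm_sq_eq]
  rw [hL, ← Measure.map_map (by fun_prop) (by fun_prop)]
  unfold gaussPi
  rw [map_pi_eq_stdGaussian, IsGaussian.map_eq_gaussianReal, integral_strongDual_stdGaussian,
    variance_dual_stdGaussian, hn]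

theorem gaussPi_linear_ne_zero {κ : Type*} [Fintype κ] {a : κ → ℝ} {i₀ : κ} (ha : a i₀ ≠ 0) :
    ∀ᵐ x ∂gaussPi κ, ∑ i, a i * x i ≠ 0 := by
  have hpos : 0 < ∑ i, a i ^ 2 :=
    Finset.sum_pos' (fun i _ => sq_nonneg _) ⟨i₀, Finset.mem_univ _, by positivity⟩
  have : NullSingletonClass (gaussianReal 0 (∑ i, a i ^ 2).toNNReal) :=
    nullSingletonClass_gaussianReal (Real.toNNReal_pos.2 hpos).ne'
  have h0 : gaussianReal 0 (∑ i, a i ^ 2).toNNReal {0} = 0 := measure_singleton 0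
  rw [← map_gaussPi_linear, Measure.map_apply (by fun_prop) (measurableSet_singleton 0)] at h0
  exact measure_eq_zero_iff_ae_notMem.1 h0

theorem lintegral_exp_sq_gaussianReal :
    ∫⁻ y, ENNReal.ofReal (Real.exp (y ^ 2 / 4)) ∂gaussianReal 0 1 = ENNReal.ofReal (√2) := by
  rw [gaussianReal_of_var_ne_zero _ one_ne_zero, lintegral_withDensity_eq_lintegral_mul _
    (measurable_gaussianPDF 0 1) (by fun_prop)]
  -- The tilt turns `exp(-y²/2)` into `exp(-y²/4)`, the unnormalised density of variance 2; `√2` is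
  -- the ratio of normalisations.
  have h : ∀ y : ℝ, (gaussianPDF 0 1 * fun y => ENNReal.ofReal (Real.exp (y ^ 2 / 4))) y =
      ENNReal.ofReal (√2) * ENNReal.ofReal (gaussianPDFReal 0 2 y) := by
    intro y
    rw [Pi.mul_apply, gaussianPDF, ← ENNReal.ofReal_mul (gaussianPDFReal_nonneg _ _ _),
      ← ENNReal.ofReal_mul (by positivity)]
    congr 1
    simp only [gaussianPDFReal, sub_zero, NNReal.coe_one, mul_one, NNReal.coe_ofNat]
    rw [mul_assoc, ← Real.exp_add, Real.sqrt_mul (by positivity) 2, mul_inv]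
    have : √2 ≠ 0 := by positivity
    field_simp
    ring_nf
  simp_rw [h]
  rw [lintegral_const_mul _ (by fun_prop), lintegral_gaussianPDFReal_eq_one _ two_ne_zero, mul_one]

theorem lintegral_exp_mean_sq {κ : Type*} [Fintype κ] [Nonempty κ] :
    ∫⁻ x, ENNReal.ofReal (Real.exp (Fintype.card κ * mean x ^ 2 / 4)) ∂gaussPi κ =
      ENNReal.ofReal (√2) := by
  have hb : (0 : ℝ) < Fintype.card κ := Nat.cast_pos.2 Fintype.card_pos
  have hmap := map_gaussPi_linear fun _ : κ => (√(Fintype.card κ))⁻¹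
  have h1 : (∑ _ : κ, (√(Fintype.card κ : ℝ))⁻¹ ^ 2).toNNReal = 1 := by
    rw [Finset.sum_const, Finset.card_univ, nsmul_eq_mul, inv_pow, Real.sq_sqrt hb.le,
      mul_inv_cancel₀ hb.ne', Real.toNNReal_one]
  rw [h1] at hmap
  rw [← lintegral_exp_sq_gaussianReal, ← hmap, lintegral_map (by fun_prop) (by fun_prop)]
  refine lintegral_congr fun x => ?_
  rw [← Finset.mul_sum, mul_pow, inv_pow, Real.sq_sqrt hb.le, mean, div_pow]
  congr 3
  field_simp

/-! ### Cyclic shifts and the bridge probability -/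

section Cyclic

variable {b : ℕ} [NeZero b]

theorem suffixSum_eq_zero {x : Fin b → ℝ} {s : Fin b} (hs : s ≠ 0) (hx : IsBridge x)
    (hxs : IsBridge (x ∘ Equiv.addRight s)) :
    ∑ k, (if s ≤ k then x k - mean x else 0) = 0 := by
  refine le_antisymm (hx s) ?_
  -- The suffix of the shifted family starting at `-s` is the prefix `k < s` of `x`. Its centred sum
  -- is nonpositive and the total is zero, so the suffix sum from `s` is also nonnegative.
  have h1 := hxs (-s)
  rw [mean_comp_equiv, ← (Equiv.subRight s).sum_comp] at h1
  have h2 : ∀ k : Fin b, (if -s ≤ (Equiv.subRight s) k then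
      (x ∘ Equiv.addRight s) ((Equiv.subRight s) k) - mean x else 0) =
      (x k - mean x) - (if s ≤ k then x k - mean x else 0) := by
    intro k
    have : -s ≤ k - s ↔ ¬ s ≤ k := by
      have hs' : (s : ℕ) ≠ 0 := fun h => hs (Fin.ext h)
      have e1 : ((-s : Fin b) : ℕ) = b - s := by
        rw [Fin.val_neg, if_neg hs]
      rw [Fin.le_def, e1]
      constructor
      · intro h hsk
        rw [Fin.sub_val_of_le hsk] at h
        have := k.2; have := s.2
        omega
      · intro h
        rw [Fin.coe_sub_iff_lt.2 (not_le.1 h)]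
        omega
    simp only [Equiv.subRight_apply, Equiv.coe_addRight, Function.comp, sub_add_cancel, this]
    split_ifs <;> simp
  simp only [h2] at h1
  have h3 : ∑ k, (x k - mean x) = 0 := by
    have hb : (b : ℝ) ≠ 0 := Nat.cast_ne_zero.2 (NeZero.ne b)
    rw [Finset.sum_sub_distrib, Finset.sum_const, Finset.card_univ, Fintype.card_fin, nsmul_eq_mul,
      mean, Fintype.card_fin, mul_div_cancel₀ _ hb, sub_self]
  rw [Finset.sum_sub_distrib, h3] at h1
  linarith

theorem ae_suffixSum_ne_zero :
    ∀ᵐ x ∂gaussPi (Fin b), ∀ s : Fin b, s ≠ 0 →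
      ∑ k, (if s ≤ k then x k - mean x else 0) ≠ 0 := by
  refine ae_all_iff.2 fun s => ?_
  by_cases hs : s = 0
  · exact Filter.Eventually.of_forall fun x h => absurd hs h
  set N : ℝ := ∑ k : Fin b, if s ≤ k then 1 else 0 with hN
  have hNpos : 0 < N := Finset.sum_pos' (fun k _ => by positivity) ⟨s, Finset.mem_univ _, by simp⟩
  have hb : (b : ℝ) ≠ 0 := Nat.cast_ne_zero.2 (NeZero.ne b)
  -- As `s ≠ 0`, index `0` lies outside the suffix and has coefficient `-N / b`; the linear form is
  -- therefore nonzero and its Gaussian law has no atom.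
  have ha : (fun k : Fin b => (if s ≤ k then 1 else 0) - N / b) 0 ≠ 0 := by
    have : ¬ s ≤ 0 := fun h => hs (nonpos_iff_eq_zero.1 h)
    simp only [this, if_false, zero_sub, neg_ne_zero]
    positivity
  filter_upwards [gaussPi_linear_ne_zero
    (a := fun k : Fin b => (if s ≤ k then 1 else 0) - N / b) (i₀ := 0) ha] with x hx _
  convert hx using 1
  have : ∀ k, (if s ≤ k then x k - mean x else 0) =
      (if s ≤ k then 1 else 0) * x k - (if s ≤ k then 1 else 0) * mean x := by
    intro k; split_ifs <;> simp
  simp only [this, sub_mul, Finset.sum_sub_distrib, ← Finset.sum_mul, ← Finset.mul_sum, ← hN]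
  rw [mean, Fintype.card_fin]
  ring

/-- Two distinct shifts that are both bridges would force a nontrivial centred suffix sum to vanish,
a null event. -/
theorem ae_sum_isBridge_le_one :
    ∀ᵐ x ∂gaussPi (Fin b), ∑ r : Fin b,
      (open Classical in if IsBridge (x ∘ Equiv.addRight r) then (1 : ENNReal) else 0) ≤ 1 := by
  classical
  have hall : ∀ᵐ x ∂gaussPi (Fin b), ∀ r : Fin b, ∀ s : Fin b, s ≠ 0 →
      ∑ k, (if s ≤ k then (x ∘ Equiv.addRight r) k - mean (x ∘ Equiv.addRight r) else 0) ≠ 0 :=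
    ae_all_iff.2 fun r =>
      (measurePreserving_gaussPi_comp (Equiv.addRight r)).quasiMeasurePreserving.ae
        ae_suffixSum_ne_zero
  filter_upwards [hall] with x hx
  rw [← Finset.sum_filter, Finset.sum_const, nsmul_eq_mul, mul_one, Nat.cast_le_one]
  refine Finset.card_le_one.2 fun r hr r' hr' => ?_
  by_contra hne
  have hr := (Finset.mem_filter.1 hr).2
  have hr' := (Finset.mem_filter.1 hr').2
  have hs : r' - r ≠ 0 := sub_ne_zero.2 (Ne.symm hne)
  refine hx r (r' - r) hs (suffixSum_eq_zero hs hr ?_)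
  convert hr' using 1
  funext k
  simp only [Function.comp, Equiv.coe_addRight]
  congr 1
  abel

/-- A cyclic rearrangement of Gaussian noise is a bridge with probability at most `1 / b`. -/
theorem lintegral_isBridge_le (f : (Fin b → ℝ) → ENNReal) (hf : Measurable f)
    (hinv : ∀ x r, f (x ∘ Equiv.addRight r) = f x) :
    b * ∫⁻ x, (open Classical in if IsBridge x then 1 else 0) * f x ∂gaussPi (Fin b) ≤
      ∫⁻ x, f x ∂gaussPi (Fin b) := by
  classical
  have hmeas : Measurable fun x : Fin b → ℝ => (if IsBridge x then (1 : ENNReal) else 0) :=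
    Measurable.ite measurableSet_isBridge measurable_const measurable_const
  calc (b : ENNReal) * ∫⁻ x, (if IsBridge x then 1 else 0) * f x ∂gaussPi (Fin b)
      = ∑ r : Fin b, ∫⁻ x, (if IsBridge (x ∘ Equiv.addRight r) then 1 else 0) * f x
          ∂gaussPi (Fin b) := by
        rw [Finset.sum_congr rfl fun r _ => ?_, Finset.sum_const, Finset.card_univ,
          Fintype.card_fin, nsmul_eq_mul]
        rw [← lintegral_gaussPi_comp (Equiv.addRight r)
          fun x => (if IsBridge x then 1 else 0) * f x]
        simp only [hinv]
    _ = ∫⁻ x, (∑ r : Fin b, if IsBridge (x ∘ Equiv.addRight r) then 1 else 0) * f x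
          ∂gaussPi (Fin b) := by
        rw [← lintegral_finsetSum]
        · simp only [Finset.sum_mul]
        · exact fun r _ => (hmeas.comp
            (measurePreserving_gaussPi_comp (Equiv.addRight r)).measurable).mul hf
    _ ≤ ∫⁻ x, f x ∂gaussPi (Fin b) := by
        refine lintegral_mono_ae ?_
        filter_upwards [ae_sum_isBridge_le_one (b := b)] with x hx
        exact mul_le_of_le_one_left' hx

end Cyclic

/-! ### Recursion for the exponential moment -/

/-- Once the sum over positions has removed the coupling through `a`, the integrand factorises. The
mean is invariant under cyclic shifts, so the bridge factor absorbs `b`. -/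
theorem lintegral_blockWeight_le {κ : Type*} [Fintype κ] [LinearOrder κ] {b : ℕ} (hb : 1 ≤ b)
    (s : Finset ℕ) :
    b * ∑ a ∈ s, ∫⁻ q : (Fin b → ℝ) × (κ → ℝ), blockWeight a q.1 q.2
        ∂(gaussPi (Fin b)).prod (gaussPi κ) ≤ 2 * isoMoment κ := by
  classical
  have : NeZero b := ⟨by omega⟩
  have hmean := measurable_mean (κ := Fin b)
  have hsq := (continuous_isoSq (ι := κ)).measurable
  have hmeas : Measurable fun x : Fin b → ℝ => (if IsBridge x then (1 : ENNReal) else 0) :=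
    Measurable.ite measurableSet_isBridge measurable_const measurable_const
  set F : (Fin b → ℝ) → ENNReal := fun x =>
    ENNReal.ofReal (Real.exp (Fintype.card (Fin b) * mean x ^ 2 / 4)) with hF
  set g : (κ → ℝ) → ENNReal := fun y => ENNReal.ofReal (Real.exp (isoSq y / 4)) with hg
  have hFm : Measurable F := by fun_prop
  have hgm : Measurable g := by fun_prop
  have h1 : ∑ a ∈ s,
      ∫⁻ q : (Fin b → ℝ) × (κ → ℝ), blockWeight a q.1 q.2
        ∂(gaussPi (Fin b)).prod (gaussPi κ) ≤
      (∫⁻ x, (if IsBridge x then 1 else 0) * F x ∂gaussPi (Fin b)) * isoMoment κ := by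
    have h0 : ∀ q : (Fin b → ℝ) × (κ → ℝ), ∑ a ∈ s, blockWeight a q.1 q.2 ≤
        ((if IsBridge q.1 then 1 else 0) * F q.1) * g q.2 := by
      intro q
      have := sum_blockWeight_le s q.1 q.2
      convert this
    rw [← lintegral_finsetSum _ fun a _ => measurable_blockWeight a]
    refine (lintegral_mono h0).trans (le_of_eq ?_)
    exact lintegral_prod_mul (f := fun x => (if IsBridge x then 1 else 0) * F x) (g := g)
      (hmeas.mul hFm).aemeasurable hgm.aemeasurable
  have h2 : (b : ENNReal) * ∫⁻ x, (if IsBridge x then 1 else 0) * F x ∂gaussPi (Fin b) ≤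
      ∫⁻ x, F x ∂gaussPi (Fin b) :=
    lintegral_isBridge_le F hFm fun x r => by simp only [hF, mean_comp_equiv]
  have h3 : ∫⁻ x, F x ∂gaussPi (Fin b) ≤ 2 := by
    rw [hF, lintegral_exp_mean_sq]
    have : √2 ≤ 2 := by
      rw [Real.sqrt_le_left (by norm_num)]; norm_num
    exact (ENNReal.ofReal_le_ofReal this).trans (by simp)
  calc _ ≤ (b : ENNReal) * ((∫⁻ x, (if IsBridge x then 1 else 0) * F x ∂gaussPi (Fin b)) *
        isoMoment κ) := by gcongr
    _ = (b * ∫⁻ x, (if IsBridge x then 1 else 0) * F x ∂gaussPi (Fin b)) *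
        isoMoment κ := (mul_assoc _ _ _).symm
    _ ≤ _ := by gcongr; exact h2.trans h3

theorem measurable_blockWeight_restrict {ι : Type*} [Fintype ι] [LinearOrder ι] (a : ℕ)
    (p : ι → Prop) [DecidablePred p] :
    Measurable fun z : ι → ℝ => blockWeight a (fun k : {k // p k} => z k)
      (fun k : {k // ¬ p k} => z k) :=
  (measurable_blockWeight (κ := {k // p k}) (κ' := {k // ¬ p k}) a).comp
    (f := fun z : ι → ℝ => ((fun k : {k // p k} => z k), (fun k : {k // ¬ p k} => z k)))
    (Measurable.prodMk (by fun_prop) (by fun_prop))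

theorem isoMoment_recursion (m : ℕ) :
    m * isoMoment (Fin m) ≤ 2 * ∑ b ∈ Finset.Icc 1 m, isoMoment (Fin (m - b)) := by
  have hmeas : ∀ b a : ℕ, Measurable fun z : Fin m → ℝ => blockWeight a
      (fun k : {k : Fin m // a ≤ k ∧ k < a + b} => z k)
      (fun k : {k : Fin m // ¬ (a ≤ k ∧ k < a + b)} => z k) :=
    fun b a => measurable_blockWeight_restrict a fun k : Fin m => a ≤ k ∧ k < a + b
  have hsq := (continuous_isoSq (ι := Fin m)).measurable
  rw [isoMoment, ← lintegral_const_mul _ (by fun_prop)]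
  refine (lintegral_mono exp_isoSq_le_sum_blockWeight).trans ?_
  rw [lintegral_finsetSum _ fun b _ => Finset.measurable_sum _ fun a _ => (hmeas b a).const_mul _,
    Finset.mul_sum]
  refine Finset.sum_le_sum fun b hb => ?_
  obtain ⟨hb1, hbm⟩ := Finset.mem_Icc.1 hb
  refine le_trans (le_of_eq ?_) (lintegral_blockWeight_le hb1 (Finset.range (m - b + 1)))
  rw [lintegral_finsetSum _ fun a _ => (hmeas b a).const_mul _, Finset.mul_sum]
  refine Finset.sum_congr rfl fun a ha => ?_
  have ha := Finset.mem_range.1 ha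
  have hcard : Fintype.card {k : Fin m // a ≤ k ∧ k < a + b} = b := by
    rw [Fintype.card_subtype]
    have : (Finset.univ.filter fun k : Fin m => a ≤ k ∧ k < a + b).map Fin.valEmbedding =
        Finset.Ico a (a + b) := by
      ext k
      simp only [Finset.mem_map, Finset.mem_filter, Finset.mem_univ, true_and, Finset.mem_Ico,
        Fin.valEmbedding_apply]
      exact ⟨fun ⟨l, hl, h⟩ => h ▸ hl, fun h => ⟨⟨k, by omega⟩, h, rfl⟩⟩
    rw [← Finset.card_map, this, Nat.card_Ico, Nat.add_sub_cancel_left]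
  have hcard' : Fintype.card {k : Fin m // ¬ (a ≤ k ∧ k < a + b)} = m - b := by
    rw [Fintype.card_subtype_compl, hcard, Fintype.card_fin]
  -- Only the sizes `b` and `m - b` matter, so all positions can be moved to the same product space.
  rw [lintegral_const_mul _ (hmeas b a), lintegral_gaussPi_subtype, lintegral_blockWeight_congr a
    (hcard.trans (Fintype.card_fin b).symm) (hcard'.trans (Fintype.card_fin _).symm)]

theorem isoMoment_fin_le (m : ℕ) : isoMoment (Fin m) ≤ m + 1 := by
  induction m using Nat.strong_induction_on with
  | _ m ih =>
    rcases Nat.eq_zero_or_pos m with rfl | hm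
    · simp [isoMoment, isoSq]
    · have h := isoMoment_recursion m
      have h1 : 2 * ∑ b ∈ Finset.Icc 1 m, isoMoment (Fin (m - b)) ≤ (m : ENNReal) * (m + 1) := by
        have h2 : ∑ b ∈ Finset.Icc 1 m, isoMoment (Fin (m - b)) ≤
            ∑ b ∈ Finset.Icc 1 m, (((m - b + 1 : ℕ)) : ENNReal) :=
          Finset.sum_le_sum fun b hb => by
            have := Finset.mem_Icc.1 hb
            push_cast [Nat.cast_add, Nat.cast_one]
            have := ih (m - b) (by omega)
            simpa using this
        refine (mul_le_mul' le_rfl h2).trans (le_of_eq ?_)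
        -- The bound `m + 1` solves the recursion with equality; this is why `√2` was rounded up to
        -- 2.
        have h3 : 2 * ∑ b ∈ Finset.Icc 1 m, (m - b + 1) = m * (m + 1) := by
          rw [Finset.sum_nbij' (t := Finset.Icc 1 m) (g := fun b => b) (fun b => m + 1 - b)
            (fun b => m + 1 - b)]
          · clear * -
            induction m with
            | zero => simp
            | succ k ihk => rw [Finset.sum_Icc_succ_top (by omega), mul_add, ihk]; ring
          all_goals
            intro b hb
            have := Finset.mem_Icc.1 hb
            first | exact Finset.mem_Icc.2 (by omega) | omega
        exact_mod_cast h3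
      have h4 := h.trans h1
      exact (ENNReal.mul_le_mul_iff_right (by simpa using hm.ne') (ENNReal.natCast_ne_top m)).1 h4

theorem isoMoment_le {κ : Type*} [Fintype κ] [LinearOrder κ] :
    isoMoment κ ≤ Fintype.card κ + 1 := by
  rw [isoMoment_congr (ι := Fin (Fintype.card κ)) (Fintype.card_fin _).symm]
  exact isoMoment_fin_le _

/-! ### Unimodal vectors -/

/-- Exponential weight of the projections onto the cones of vectors that decrease before `i₀` and
increase from `i₀` on, summed over the turning point `i₀`. -/
noncomputable def unimodalWeight {κ : Type*} [Fintype κ] [LinearOrder κ] (z : κ → ℝ) : ENNReal :=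
  ∑ i₀ : κ,
    ENNReal.ofReal (Real.exp
      (isoSq (ι := {i // i < i₀}ᵒᵈ) ((fun i : {i // i < i₀} => z i) ∘ OrderDual.ofDual) / 4)) *
    ENNReal.ofReal (Real.exp (isoSq (fun i : {i // ¬ i < i₀} => z i) / 4))

theorem measurable_exp_isoSq_comp {κ κ' : Type*} [Fintype κ'] [LinearOrder κ'] (g : κ' → κ) :
    Measurable fun z : κ → ℝ => ENNReal.ofReal (Real.exp (isoSq (fun i => z (g i)) / 4)) := by
  have h : Measurable fun z : κ → ℝ => isoSq (fun i => z (g i)) :=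
    continuous_isoSq.measurable.comp (by fun_prop)
  fun_prop

section

variable {κ : Type*} [Fintype κ] [LinearOrder κ]

theorem measurable_unimodalWeight : Measurable (unimodalWeight : (κ → ℝ) → ENNReal) :=
  Finset.measurable_sum _ fun i₀ _ =>
    (measurable_exp_isoSq_comp fun i : {i // i < i₀}ᵒᵈ => (OrderDual.ofDual i).1).mul
      (measurable_exp_isoSq_comp fun i : {i // ¬ i < i₀} => i.1)

/-- The right-hand side does not depend on `v` or `i₀`, so both may be chosen from the data. Order
reversal makes the decreasing part monotone. -/
theorem exp_le_unimodalWeight (z v : κ → ℝ) (i₀ : κ)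
    (hanti : ∀ i j, i ≤ j → j < i₀ → v j ≤ v i) (hmono : ∀ i j, i₀ ≤ i → i ≤ j → v i ≤ v j) :
    ENNReal.ofReal (Real.exp ((∑ i, (2 * z i * v i - v i ^ 2)) / 4)) ≤ unimodalWeight z := by
  refine le_trans ?_ (Finset.single_le_sum (fun _ _ => zero_le) (Finset.mem_univ i₀))
  rw [← ENNReal.ofReal_mul (Real.exp_nonneg _), ← Real.exp_add, ← add_div,
    ← Fintype.sum_subtype_add_sum_subtype (fun i => i < i₀)]
  refine ENNReal.ofReal_le_ofReal (Real.exp_le_exp.2 ?_)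
  gcongr
  · exact sum_le_isoSq (ι := {i // i < i₀}ᵒᵈ) ((fun i : {i // i < i₀} => z i) ∘ OrderDual.ofDual)
      (v := (fun i : {i // i < i₀} => v i) ∘ OrderDual.ofDual)
      fun i j hij => hanti _ _ hij (OrderDual.ofDual i).2
  · exact sum_le_isoSq (fun i : {i // ¬ i < i₀} => z i)
      (v := fun i : {i // ¬ i < i₀} => v i) fun i j hij => hmono _ _ (not_lt.1 i.2) hij

theorem lintegral_unimodalWeight_le [Nonempty κ] :
    ∫⁻ z : κ → ℝ, unimodalWeight z ∂gaussPi κ ≤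
      ENNReal.ofReal ((Real.exp 1 * Fintype.card κ) ^ 4) := by
  have hterm : ∀ i₀ : κ, ∫⁻ z : κ → ℝ,
      ENNReal.ofReal (Real.exp
        (isoSq (ι := {i // i < i₀}ᵒᵈ) ((fun i : {i // i < i₀} => z i) ∘ OrderDual.ofDual) / 4)) *
      ENNReal.ofReal (Real.exp (isoSq (fun i : {i // ¬ i < i₀} => z i) / 4)) ∂gaussPi κ ≤
      (Fintype.card κ + 1) * (Fintype.card κ + 1) := by
    intro i₀
    have h2 := (continuous_isoSq (ι := {i // ¬ i < i₀})).measurable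
    rw [lintegral_gaussPi_subtype (fun i => i < i₀) fun x y => ENNReal.ofReal (Real.exp
      (isoSq (ι := {i // i < i₀}ᵒᵈ) (x ∘ OrderDual.ofDual) / 4)) *
      ENNReal.ofReal (Real.exp (isoSq y / 4)),
      lintegral_prod_mul (f := fun x : {i // i < i₀} → ℝ => ENNReal.ofReal (Real.exp
      (isoSq (ι := {i // i < i₀}ᵒᵈ) (x ∘ OrderDual.ofDual) / 4)))
      (g := fun y : {i // ¬ i < i₀} → ℝ => ENNReal.ofReal (Real.exp (isoSq y / 4)))
      ?_ (by fun_prop)]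
    · refine mul_le_mul' ?_ ?_
      · rw [lintegral_gaussPi_comp (κ := {i // i < i₀}ᵒᵈ) OrderDual.ofDual
          fun x => ENNReal.ofReal (Real.exp (isoSq x / 4))]
        refine (isoMoment_le (κ := {i // i < i₀}ᵒᵈ)).trans ?_
        gcongr
        rw [Fintype.card_orderDual]
        exact Fintype.card_subtype_le _
      · refine (isoMoment_le (κ := {i // ¬ i < i₀})).trans ?_
        gcongr
        exact Fintype.card_subtype_le _
    · have h1 : Measurable fun x : {i // i < i₀} → ℝ =>
          isoSq (ι := {i // i < i₀}ᵒᵈ) (x ∘ OrderDual.ofDual) :=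
        continuous_isoSq.measurable.comp (measurable_pi_lambda _ fun i => measurable_pi_apply _)
      exact Measurable.aemeasurable (by fun_prop)
  have hm : (1 : ℝ) ≤ Fintype.card κ := Nat.one_le_cast.2 Fintype.card_pos
  unfold unimodalWeight
  rw [lintegral_finsetSum']
  · refine (Finset.sum_le_sum fun i₀ _ => hterm i₀).trans ?_
    rw [Finset.sum_const, Finset.card_univ, nsmul_eq_mul]
    have : (Fintype.card κ : ENNReal) * ((Fintype.card κ + 1) * (Fintype.card κ + 1)) =
        ENNReal.ofReal ((Fintype.card κ : ℝ) * ((Fintype.card κ + 1) * (Fintype.card κ + 1))) := by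
      rw [show (Fintype.card κ : ℝ) * ((Fintype.card κ + 1) * (Fintype.card κ + 1)) =
        ((Fintype.card κ * ((Fintype.card κ + 1) * (Fintype.card κ + 1)) : ℕ) : ℝ) by push_cast; ring,
        ENNReal.ofReal_natCast]
      push_cast
      rfl
    rw [this]
    refine ENNReal.ofReal_le_ofReal ?_
    set m : ℝ := (Fintype.card κ : ℝ)
    have he : (2 : ℝ) ≤ Real.exp 1 := by
      have := Real.add_one_le_exp (1 : ℝ); linarith
    -- The slack `4m ≥ 1` yields a pure fourth power of `em`, whose logarithm matches the penalty.
    calc m * ((m + 1) * (m + 1)) ≤ m * ((2 * m) * (2 * m)) * (4 * m) := by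
          have : m * ((m + 1) * (m + 1)) ≤ m * ((2 * m) * (2 * m)) := by gcongr <;> linarith
          refine this.trans (le_mul_of_one_le_right (by positivity) (by linarith))
      _ = (2 * m) ^ 4 := by ring
      _ ≤ (Real.exp 1 * m) ^ 4 := by gcongr
  · exact fun i₀ _ => ((measurable_exp_isoSq_comp fun i : {i // i < i₀}ᵒᵈ =>
      (OrderDual.ofDual i).1).mul
      (measurable_exp_isoSq_comp fun i : {i // ¬ i < i₀} => i.1)).aemeasurable

/-- The turning point is an index minimising `g ∘ y`; convexity bounds each intermediate value by
the larger endpoint value. -/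
theorem ConvexOn.exists_unimodal [Nonempty κ] {g : ℝ → ℝ} (hg : ConvexOn ℝ Set.univ g)
    {y : κ → ℝ} (hy : Monotone y) :
    ∃ i₀, (∀ i j, i ≤ j → j < i₀ → g (y j) ≤ g (y i)) ∧
      ∀ i j, i₀ ≤ i → i ≤ j → g (y i) ≤ g (y j) := by
  obtain ⟨i₀, hi₀⟩ := Finite.exists_min fun i => g (y i)
  refine ⟨i₀, fun i j hij hj => ?_, fun i j hi hij => ?_⟩
  · have := hg.le_max_of_mem_Icc (Set.mem_univ (y i)) (Set.mem_univ (y i₀)) ⟨hy hij, hy hj.le⟩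
    rwa [max_eq_left (hi₀ i)] at this
  · have := hg.le_max_of_mem_Icc (Set.mem_univ (y i₀)) (Set.mem_univ (y j)) ⟨hy hi, hy hij⟩
    rwa [max_eq_right (hi₀ j)] at this

end

/-! ### Independence across blocks -/

section Parts

variable {ι : Type*} [Fintype ι] [DecidableEq ι]

theorem lintegral_gaussPi_restrict (T : Finset ι) (f : ({i // i ∈ T} → ℝ) → ENNReal)
    (hf : Measurable f) :
    ∫⁻ z, f (fun i => z i) ∂gaussPi ι = ∫⁻ x, f x ∂gaussPi {i // i ∈ T} := by
  rw [lintegral_gaussPi_subtype (fun i => i ∈ T) fun x _ => f x]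
  have := lintegral_prod_mul (μ := gaussPi {i // i ∈ T}) (ν := gaussPi {i // ¬ i ∈ T})
    (g := fun _ => 1) hf.aemeasurable aemeasurable_const
  simp only [mul_one, lintegral_const, measure_univ] at this
  rw [← this]
  congr!

theorem lintegral_prod_restrict (S : Finset (Finset ι))
    (hS : ∀ T ∈ S, ∀ T' ∈ S, T ≠ T' → Disjoint T T')
    (f : ∀ T : Finset ι, ({i // i ∈ T} → ℝ) → ENNReal) (hf : ∀ T, Measurable (f T)) :
    ∫⁻ z, ∏ T ∈ S, f T (fun i => z i) ∂gaussPi ι =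
      ∏ T ∈ S, ∫⁻ x, f T x ∂gaussPi {i // i ∈ T} := by
  induction S using Finset.induction_on with
  | empty => simp
  | insert T S hT ih =>
    rw [Finset.prod_insert hT, ← ih fun T₁ h₁ T₂ h₂ => hS _ (Finset.mem_insert_of_mem h₁) _
      (Finset.mem_insert_of_mem h₂), ← lintegral_gaussPi_restrict T (f T) (hf T)]
    simp only [Finset.prod_insert hT]
    have hdisj : Disjoint T (S.biUnion id) := by
      rw [Finset.disjoint_biUnion_right]
      exact fun T' hT' => hS T (Finset.mem_insert_self _ _) T' (Finset.mem_insert_of_mem hT')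
        fun h => hT (h ▸ hT')
    have hind : iIndepFun (fun (i : ι) (z : ι → ℝ) => z i) (gaussPi ι) :=
      iIndepFun_pi (X := fun _ => id) fun _ => aemeasurable_id
    have h1 := hind.indepFun_finset T (S.biUnion id) hdisj fun i => measurable_pi_apply i
    -- `attach` provides the membership proofs that exhibit the remaining product as a function of
    -- the coordinates in the union of the other blocks.
    have h2 := h1.comp (φ := f T) (ψ := fun y => ∏ T' ∈ S.attach, f T'.1 fun i =>
      y ⟨i.1, Finset.mem_biUnion.2 ⟨T'.1, T'.2, i.2⟩⟩) (hf T)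
      (Finset.measurable_prod _ fun T' _ => (hf T'.1).comp
        (measurable_pi_lambda _ fun i => measurable_pi_apply _))
    have hm : ∀ T' : Finset ι, Measurable fun z : ι → ℝ => f T' fun i => z i := fun T' =>
      (hf T').comp (measurable_pi_lambda _ fun i => measurable_pi_apply _)
    refine lintegral_mul_eq_lintegral_mul_lintegral_of_indepFun'' (hm T).aemeasurable
      (Finset.measurable_prod _ fun T' _ => hm T').aemeasurable ?_
    have h3 : (fun z : ι → ℝ => ∏ T' ∈ S, f T' fun i => z i) =
        fun z => ∏ T' ∈ S.attach, f T'.1 fun i => z i :=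
      funext fun z => (Finset.prod_attach S fun T' => f T' fun i => z i).symm
    rw [h3]
    exact h2

end Parts

/-! ### Least squares over the convex cone and the oracle inequality -/

theorem convex_convexSeq {n : ℕ} (x : Fin n → ℝ) : Convex ℝ (convexSeq x) := by
  rintro u ⟨f, hf, hu⟩ v ⟨g, hg, hv⟩ a b ha hb _
  exact ⟨fun s => a * f s + b * g s, (hf.smul ha).add (hg.smul hb), fun i => by simp [hu, hv]⟩

theorem IsLeastSquares.sum_mul_le_zero {n : ℕ} (hn : 0 < n) {K : Set (EuclideanSpace ℝ (Fin n))}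
    (hK : Convex ℝ K) {y v u : EuclideanSpace ℝ (Fin n)} (hv : IsLeastSquares K y v) (hu : u ∈ K) :
    ∑ i, (y i - v i) * (u i - v i) ≤ 0 := by
  set A := ∑ i, (y i - v i) * (u i - v i) with hA
  set B := ∑ i, (u i - v i) ^ 2 with hB
  have hB0 : 0 ≤ B := Finset.sum_nonneg fun i _ => sq_nonneg _
  have hn' : (0 : ℝ) < 1 / n := by positivity
  have key : ∀ θ : ℝ, 0 < θ → θ ≤ 1 → 2 * A ≤ θ * B := by
    intro θ h0 h1
    have hmem : v + θ • (u - v) ∈ K := hK.add_smul_sub_mem hv.1 hu ⟨h0.le, h1⟩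
    have h := le_of_mul_le_mul_left (hv.2 _ hmem) hn'
    have e : ∑ i, ((y - (v + θ • (u - v))) i) ^ 2 - ∑ i, ((y - v) i) ^ 2 =
        θ * (θ * B - 2 * A) := by
      rw [hA, hB, ← Finset.sum_sub_distrib, Finset.mul_sum, Finset.mul_sum,
        ← Finset.sum_sub_distrib, Finset.mul_sum]
      refine Finset.sum_congr rfl fun i _ => ?_
      simp only [PiLp.sub_apply, PiLp.add_apply, PiLp.smul_apply, smul_eq_mul]
      ring
    have : 0 ≤ θ * (θ * B - 2 * A) := by linarith
    have := nonneg_of_mul_nonneg_right this h0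
    linarith
  by_contra! hpos
  -- If `A > 0`, this step length gives `2A(A + B) ≤ AB`, which is impossible for `B ≥ 0`.
  have h := key (A / (A + B)) (by positivity) (div_le_one_of_le₀ (by linarith) (by linarith))
  have hAB : 0 < A + B := by linarith
  rw [div_mul_eq_mul_div, le_div_iff₀ hAB] at h
  nlinarith

/-- The basic inequality for a least squares estimator over a convex set. -/
theorem IsLeastSquares.sum_sq_sub_le {n : ℕ} (hn : 0 < n) {K : Set (EuclideanSpace ℝ (Fin n))}
    (hK : Convex ℝ K) {μ ξ v u : EuclideanSpace ℝ (Fin n)} (hv : IsLeastSquares K (μ + ξ) v)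
    (hu : u ∈ K) :
    ∑ i, (v i - μ i) ^ 2 ≤
      ∑ i, (u i - μ i) ^ 2 + ∑ i, (2 * ξ i * (v i - u i) - (v i - u i) ^ 2) := by
  have h := hv.sum_mul_le_zero hn hK hu
  have e : ∑ i, (u i - μ i) ^ 2 + ∑ i, (2 * ξ i * (v i - u i) - (v i - u i) ^ 2) -
      ∑ i, (v i - μ i) ^ 2 = -2 * ∑ i, ((μ + ξ) i - v i) * (u i - v i) := by
    rw [← Finset.sum_add_distrib, ← Finset.sum_sub_distrib, Finset.mul_sum]
    refine Finset.sum_congr rfl fun i _ => ?_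
    rw [PiLp.add_apply]
    ring
  linarith

/-- On a block where `u` is affine, the increment `v - u` of a convex vector is convex. -/
theorem exp_block_le_unimodalWeight {n : ℕ} {x : Fin n → ℝ} (hx : StrictMono x)
    {u v : EuclideanSpace ℝ (Fin n)} (hv : v ∈ convexSeq x) {T : Finset (Fin n)}
    (hT : T.Nonempty) {a : ℝ} (ha : ∀ i ∈ T, ∀ l ∈ T, u i = a * (x i - x l) + u l) {s : ℝ}
    (hs : 0 ≤ s) (z : Fin n → ℝ) :
    ENNReal.ofReal (Real.exp ((∑ i ∈ T,
      (2 * z i * (s * (v i - u i)) - (s * (v i - u i)) ^ 2)) / 4)) ≤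
      unimodalWeight fun i : {i // i ∈ T} => z i := by
  obtain ⟨f, hf, hfv⟩ := hv
  obtain ⟨l, hl⟩ := hT
  have : Nonempty {i // i ∈ T} := ⟨⟨l, hl⟩⟩
  -- On the block, `u` agrees with an affine function of the whole line, whose subtraction preserves
  -- convexity.
  have hg : ConvexOn ℝ Set.univ fun r => s * (f r - (a * (r - x l) + u l)) := by
    refine ConvexOn.smul hs (hf.sub ⟨convex_univ, fun r _ t _ b c _ _ hbc => le_of_eq ?_⟩)
    obtain rfl : c = 1 - b := by linarith
    simp only [smul_eq_mul]
    ring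
  obtain ⟨i₀, h1, h2⟩ := hg.exists_unimodal (κ := {i // i ∈ T}) (y := fun i => x i)
    fun i j hij => hx.monotone hij
  have := exp_le_unimodalWeight (fun i : {i // i ∈ T} => z i) _ i₀ h1 h2
  refine le_trans (le_of_eq ?_) this
  rw [← Finset.sum_coe_sort]
  congr 4
  funext i
  rw [hfv, ha i i.2 l hl]

theorem map_multivariateGaussian_smul {n : ℕ} {σ : ℝ} (hσ : 0 < σ) :
    (multivariateGaussian 0 (σ ^ 2 • (1 : Matrix (Fin n) (Fin n) ℝ))).map
      (fun w i => σ⁻¹ * w i) = gaussPi (Fin n) := by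
  have hS : (σ ^ 2 • (1 : Matrix (Fin n) (Fin n) ℝ)).PosSemidef :=
    Matrix.PosSemidef.one.smul (sq_nonneg σ)
  have h : (multivariateGaussian 0 (σ ^ 2 • (1 : Matrix (Fin n) (Fin n) ℝ))).map (σ⁻¹ • ·) =
      stdGaussian (EuclideanSpace ℝ (Fin n)) := by
    refine Measure.ext_of_charFun (funext fun t => ?_)
    rw [charFun_map_smul, charFun_multivariateGaussian hS, charFun_stdGaussian]
    congr 1
    rw [← Complex.ofReal_pow, EuclideanSpace.real_norm_sq_eq]
    have hsum : dotProduct (σ⁻¹ • t).ofLp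
        ((σ ^ 2 • (1 : Matrix (Fin n) (Fin n) ℝ)).mulVec (σ⁻¹ • t).ofLp) =
        ∑ i, t i ^ 2 := by
      rw [Matrix.smul_mulVec, Matrix.one_mulVec, dotProduct]
      refine Finset.sum_congr rfl fun i _ => ?_
      simp only [PiLp.smul_apply, Pi.smul_apply, smul_eq_mul]
      field_simp
    rw [hsum, inner_zero_right, Complex.ofReal_zero, zero_mul, zero_sub, neg_div]
  have hc : (fun (w : EuclideanSpace ℝ (Fin n)) i => σ⁻¹ * w i) =
      (MeasurableEquiv.toLp 2 (Fin n → ℝ)).symm ∘ (σ⁻¹ • ·) := rfl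
  rw [hc, ← Measure.map_map (by fun_prop) (by fun_prop), h, ← map_pi_eq_stdGaussian,
    Measure.map_map (by fun_prop) (by fun_prop)]
  exact Measure.map_id

/-- Jensen's inequality for the logarithm, via its tangent at the average block size `n / q`; the
linear corrections cancel because the block sizes add up to `n`. -/
theorem sum_log_card_le {n : ℕ} (hn : 0 < n) (Q : Finpartition (Finset.univ : Finset (Fin n))) :
    ∑ T ∈ Q.parts, Real.log (Real.exp 1 * T.card) ≤
      Q.parts.card * Real.log (Real.exp 1 * n / Q.parts.card) := by
  have : Nonempty (Fin n) := ⟨⟨0, hn⟩⟩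
  have hq : 0 < (Q.parts.card : ℝ) := Nat.cast_pos.2 (Finset.card_pos.2
    (Q.parts_nonempty (by simpa using Finset.univ_nonempty.ne_empty)))
  have hn' : (0 : ℝ) < n := Nat.cast_pos.2 hn
  set q : ℝ := (Q.parts.card : ℝ) with hqdef
  have hterm : ∀ T ∈ Q.parts, Real.log (Real.exp 1 * T.card) ≤
      Real.log (Real.exp 1 * n / q) + (q / n * T.card - 1) := by
    intro T hT
    have hT0 : (0 : ℝ) < T.card := Nat.cast_pos.2 (Finset.card_pos.2 (Q.nonempty_of_mem_parts hT))
    have h1 := Real.log_le_sub_one_of_pos (show 0 < q / n * T.card by positivity)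
    have h2 : Real.log (Real.exp 1 * T.card) =
        Real.log (Real.exp 1 * n / q) + Real.log (q / n * T.card) := by
      rw [← Real.log_mul (by positivity) (by positivity)]
      congr 1
      field_simp
    linarith
  refine (Finset.sum_le_sum hterm).trans (le_of_eq ?_)
  have hsum : ∑ T ∈ Q.parts, (T.card : ℝ) = n := by
    rw [← Nat.cast_sum, Q.sum_card_parts]; simp
  rw [Finset.sum_add_distrib, Finset.sum_sub_distrib, ← Finset.mul_sum, hsum]
  simp only [Finset.sum_const, nsmul_eq_mul, ← hqdef]
  field_simp
  ring

/-- The product of the block weights has a controlled expectation. -/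
theorem lintegral_prod_unimodalWeight_le {n : ℕ} (hn : 0 < n)
    (Q : Finpartition (Finset.univ : Finset (Fin n))) :
    ∫⁻ z, ∏ T ∈ Q.parts, unimodalWeight (fun i : {i // i ∈ T} => z i) ∂gaussPi (Fin n) ≤
      ENNReal.ofReal (Real.exp
        (4 * (Q.parts.card * Real.log (Real.exp 1 * n / Q.parts.card)))) := by
  rw [lintegral_prod_restrict Q.parts (fun T hT T' hT' h => Q.disjoint hT hT' h)
    (fun T => unimodalWeight) fun T => measurable_unimodalWeight]
  have hterm : ∀ T ∈ Q.parts, ∫⁻ x, unimodalWeight x ∂gaussPi {i // i ∈ T} ≤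
      ENNReal.ofReal (Real.exp (4 * Real.log (Real.exp 1 * T.card))) := by
    intro T hT
    obtain ⟨l, hl⟩ := Q.nonempty_of_mem_parts hT
    have : Nonempty {i // i ∈ T} := ⟨⟨l, hl⟩⟩
    refine lintegral_unimodalWeight_le.trans (le_of_eq ?_)
    have hT0 : (0 : ℝ) < T.card := Nat.cast_pos.2 (Finset.card_pos.2 ⟨l, hl⟩)
    rw [Fintype.card_coe, mul_comm (4 : ℝ), Real.exp_mul, Real.exp_log (by positivity)]
    norm_cast
  refine (Finset.prod_le_prod' hterm).trans ?_
  rw [← ENNReal.ofReal_prod_of_nonneg fun _ _ => Real.exp_nonneg _, ← Real.exp_sum,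
    ← Finset.mul_sum]
  refine ENNReal.ofReal_le_ofReal (Real.exp_le_exp.2 ?_)
  have := sum_log_card_le hn Q
  linarith

/-- The oracle inequality at a fixed convex vector that is affine on the blocks of a partition. -/
theorem prob_oracle {Ω : Type*} [MeasurableSpace Ω] (P : Measure Ω) [IsProbabilityMeasure P]
    {n : ℕ} (hn : 0 < n) {x : Fin n → ℝ} (hx : StrictMono x)
    {μ : EuclideanSpace ℝ (Fin n)} {σ : ℝ} (hσ : 0 < σ) {ξ : Ω → EuclideanSpace ℝ (Fin n)}
    (hξ : HasLaw ξ (multivariateGaussian 0 (σ ^ 2 • (1 : Matrix (Fin n) (Fin n) ℝ))) P)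
    {μhat : Ω → EuclideanSpace ℝ (Fin n)}
    (hμhat : ∀ ω, IsLeastSquares (convexSeq x) (μ + ξ ω) (μhat ω)) (t : ℝ)
    {u : EuclideanSpace ℝ (Fin n)} (hu : u ∈ convexSeq x)
    (Q : Finpartition (Finset.univ : Finset (Fin n)))
    (hQ : ∀ T ∈ Q.parts, ∃ a : ℝ, ∀ i ∈ T, ∀ l ∈ T, u i = a * (x i - x l) + u l) :
    1 - Real.exp (-t) ≤ P.real {ω | scaledNormSq (μhat ω - μ) ≤
      scaledNormSq (u - μ) + 16 * σ ^ 2 * (Q.parts.card : ℝ) / (n : ℝ) *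
        Real.log (Real.exp 1 * (n : ℝ) / Q.parts.card) + 4 * σ ^ 2 * t / (n : ℝ)} := by
  set q : ℝ := (Q.parts.card : ℝ) with hq
  set Λ := Real.log (Real.exp 1 * n / q) with hΛ
  set W : (Fin n → ℝ) → ENNReal :=
    fun z => ∏ T ∈ Q.parts, unimodalWeight (fun i : {i // i ∈ T} => z i) with hW
  have hWm : Measurable W := Finset.measurable_prod _ fun T _ =>
    measurable_unimodalWeight.comp (measurable_pi_lambda _ fun i => measurable_pi_apply _)
  have hn' : (0 : ℝ) < n := Nat.cast_pos.2 hn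
  set Z : Ω → Fin n → ℝ := fun ω i => σ⁻¹ * ξ ω i with hZ
  have hmeasσ : Measurable fun (w : EuclideanSpace ℝ (Fin n)) i => σ⁻¹ * w i := by fun_prop
  have hZm : AEMeasurable Z P := hmeasσ.comp_aemeasurable hξ.aemeasurable
  have hlaw : P.map Z = gaussPi (Fin n) := by
    rw [← map_multivariateGaussian_smul hσ, ← hξ.map_eq,
      AEMeasurable.map_map_of_aemeasurable hmeasσ.aemeasurable hξ.aemeasurable]
    rfl
  set ε := ENNReal.ofReal (Real.exp (4 * (q * Λ) + t)) with hε
  set G := {ω | scaledNormSq (μhat ω - μ) ≤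
      scaledNormSq (u - μ) + 16 * σ ^ 2 * q / n * Λ + 4 * σ ^ 2 * t / n} with hG
  have hbad : Gᶜ ⊆ {ω | ε ≤ W (Z ω)} := by
    intro ω hω
    have hω : scaledNormSq (u - μ) + 16 * σ ^ 2 * q / n * Λ + 4 * σ ^ 2 * t / n <
        scaledNormSq (μhat ω - μ) := not_le.1 hω
    set v := μhat ω
    have hbasic := (hμhat ω).sum_sq_sub_le hn (convex_convexSeq x) hu
    set D := ∑ i, (2 * Z ω i * (σ⁻¹ * (v i - u i)) - (σ⁻¹ * (v i - u i)) ^ 2) with hD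
    have hDeq : ∑ i, (2 * ξ ω i * (v i - u i) - (v i - u i) ^ 2) = σ ^ 2 * D := by
      rw [hD, Finset.mul_sum]
      refine Finset.sum_congr rfl fun i _ => ?_
      simp only [hZ]
      field_simp
    have hDlt : 4 * (q * Λ) + t < D / 4 := by
      rw [hDeq] at hbasic
      simp only [scaledNormSq, PiLp.sub_apply] at hω
      have h1 := mul_lt_mul_of_pos_left hω hn'
      have h2 : (n : ℝ) * (1 / n * ∑ i, (u i - μ i) ^ 2 + 16 * σ ^ 2 * q / n * Λ +
          4 * σ ^ 2 * t / n) = ∑ i, (u i - μ i) ^ 2 + σ ^ 2 * (16 * (q * Λ) + 4 * t) := by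
        field_simp
        ring
      rw [h2, ← mul_assoc (n : ℝ), mul_one_div_cancel hn'.ne', one_mul] at h1
      have h3 : σ ^ 2 * (16 * (q * Λ) + 4 * t) < σ ^ 2 * D := by linarith
      have := lt_of_mul_lt_mul_left h3 (sq_nonneg σ)
      linarith
    refine (ENNReal.ofReal_le_ofReal (Real.exp_le_exp.2 hDlt.le)).trans ?_
    have hsplit : D = ∑ T ∈ Q.parts, ∑ i ∈ T,
        (2 * Z ω i * (σ⁻¹ * (v i - u i)) - (σ⁻¹ * (v i - u i)) ^ 2) := by
      rw [hD]
      conv_lhs => rw [← Q.biUnion_parts]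
      exact Finset.sum_biUnion Q.disjoint
    rw [hsplit, Finset.sum_div, Real.exp_sum, ENNReal.ofReal_prod_of_nonneg fun _ _ =>
      Real.exp_nonneg _]
    refine Finset.prod_le_prod' fun T hT => ?_
    obtain ⟨a, ha⟩ := hQ T hT
    exact exp_block_le_unimodalWeight hx (hμhat ω).1 (Q.nonempty_of_mem_parts hT) ha
      (inv_nonneg.2 hσ.le) (Z ω)
  have hmarkov : P {ω | ε ≤ W (Z ω)} ≤ ENNReal.ofReal (Real.exp (-t)) := by
    have h1 := mul_meas_ge_le_lintegral₀ (hWm.comp_aemeasurable hZm) ε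
    have h2 : ∫⁻ ω, W (Z ω) ∂P ≤ ENNReal.ofReal (Real.exp (4 * (q * Λ))) := by
      rw [← lintegral_map' hWm.aemeasurable hZm, hlaw]
      exact lintegral_prod_unimodalWeight_le hn Q
    have h3 : ENNReal.ofReal (Real.exp (4 * (q * Λ))) = ε * ENNReal.ofReal (Real.exp (-t)) := by
      rw [hε, ← ENNReal.ofReal_mul (Real.exp_nonneg _), ← Real.exp_add, add_neg_cancel_right]
    have h4 : ε * P {ω | ε ≤ W (Z ω)} ≤ ε * ENNReal.ofReal (Real.exp (-t)) :=
      h1.trans (h2.trans h3.le)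
    exact (ENNReal.mul_le_mul_iff_right (ENNReal.ofReal_pos.2 (Real.exp_pos _)).ne'
      ENNReal.ofReal_ne_top).1 h4
  have h5 : P.real Gᶜ ≤ Real.exp (-t) :=
    ENNReal.toReal_le_of_le_ofReal (Real.exp_nonneg _) ((measure_mono hbad).trans hmarkov)
  -- Measurability of `μhat` is not assumed, so `G` may fail to be measurable; subadditivity
  -- suffices here.
  have h6 : 1 ≤ P.real G + P.real Gᶜ := by
    rw [← probReal_univ (μ := P), ← Set.union_compl_self G]
    exact measureReal_union_le _ _
  linarith

/-! ### Attainment of the minimum -/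

theorem isClosed_convexSeq {n : ℕ} (hn : 2 ≤ n) {x : Fin n → ℝ} (hx : StrictMono x) :
    IsClosed (convexSeq x) := by
  have : convexSeq x = {u | ∀ i j k : Fin n, (j : ℕ) = i + 1 → (k : ℕ) = j + 1 →
      (u j - u i) / (x j - x i) ≤ (u k - u j) / (x k - x j)} :=
    Set.ext fun u => mem_convexSeq_iff hn hx u
  rw [this]
  simp only [Set.ofPred_forall]
  refine isClosed_iInter fun i => isClosed_iInter fun j => isClosed_iInter fun k =>
    isClosed_iInter fun _ => isClosed_iInter fun _ => isClosed_le ?_ ?_ <;> fun_prop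

/-- The vectors that are affine in the design points on every block of a partition. -/
def affineOnParts {n : ℕ} (x : Fin n → ℝ) (Q : Finpartition (Finset.univ : Finset (Fin n))) :
    Submodule ℝ (EuclideanSpace ℝ (Fin n)) where
  carrier := {u | ∀ T ∈ Q.parts, ∃ a : ℝ, ∀ i ∈ T, ∀ l ∈ T, u i = a * (x i - x l) + u l}
  add_mem' {u v} hu hv T hT := by
    obtain ⟨a, ha⟩ := hu T hT
    obtain ⟨b, hb⟩ := hv T hT
    refine ⟨a + b, fun i hi l hl => ?_⟩
    rw [PiLp.add_apply, PiLp.add_apply, ha i hi l hl, hb i hi l hl]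
    ring
  zero_mem' T hT := ⟨0, fun i _ l _ => by simp⟩
  smul_mem' c u hu T hT := by
    obtain ⟨a, ha⟩ := hu T hT
    refine ⟨c * a, fun i hi l hl => ?_⟩
    rw [PiLp.smul_apply, PiLp.smul_apply, ha i hi l hl, smul_eq_mul, smul_eq_mul]
    ring

theorem scaledNormSq_sub_eq {n : ℕ} (u v : EuclideanSpace ℝ (Fin n)) :
    scaledNormSq (u - v) = (1 / (n : ℝ)) * dist v u ^ 2 := by
  rw [scaledNormSq, dist_comm, dist_eq_norm, EuclideanSpace.real_norm_sq_eq]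

theorem exists_min_affineOnParts {n : ℕ} (hn : 2 ≤ n) {x : Fin n → ℝ} (hx : StrictMono x)
    (μ : EuclideanSpace ℝ (Fin n)) (Q : Finpartition (Finset.univ : Finset (Fin n))) :
    ∃ u ∈ convexSeq x, u ∈ affineOnParts x Q ∧ ∀ v ∈ convexSeq x, v ∈ affineOnParts x Q →
      scaledNormSq (u - μ) ≤ scaledNormSq (v - μ) := by
  have hcl : IsClosed (convexSeq x ∩ affineOnParts x Q) :=
    (isClosed_convexSeq hn hx).inter (Submodule.closed_of_finiteDimensional _)
  obtain ⟨u, hu, hd⟩ := hcl.exists_infDist_eq_dist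
    ⟨0, ⟨fun _ => 0, convexOn_const 0 convex_univ, fun i => by simp⟩, Submodule.zero_mem _⟩ μ
  refine ⟨u, hu.1, hu.2, fun v hv hv' => ?_⟩
  have h : dist μ u ≤ dist μ v := hd ▸ Metric.infDist_le_dist_of_mem ⟨hv, hv'⟩
  rw [scaledNormSq_sub_eq, scaledNormSq_sub_eq]
  gcongr

/-- The derivative of `k log(en/k)` is `log(n/k)`, nonnegative for `k ≤ n`. Thus describing a vector
by a partition with superfluous blocks only raises the penalty. -/
theorem mul_log_div_mono {n k l : ℝ} (hk : 0 < k) (hkl : k ≤ l) (hln : l ≤ n) :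
    k * Real.log (Real.exp 1 * n / k) ≤ l * Real.log (Real.exp 1 * n / l) := by
  have hl : 0 < l := hk.trans_le hkl
  have hn : 0 < n := hl.trans_le hln
  have h1 : Real.log (Real.exp 1 * n / k) = Real.log (Real.exp 1 * n / l) + Real.log (l / k) := by
    rw [← Real.log_mul (by positivity) (by positivity)]
    congr 1
    field_simp
  have h2 : k * Real.log (l / k) ≤ l - k := by
    have := mul_le_mul_of_nonneg_left (Real.log_le_sub_one_of_pos (div_pos hl hk)) hk.le
    rwa [mul_sub, mul_one, mul_div_cancel₀ _ hk.ne'] at this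
  have h3 : 1 ≤ Real.log (Real.exp 1 * n / l) := by
    rw [Real.le_log_iff_exp_le (by positivity), le_div_iff₀ hl]
    gcongr
  have h4 := mul_le_mul_of_nonneg_left h3 (sub_nonneg.2 hkl)
  rw [h1]
  linarith

/-- For each partition the loss has a minimiser over a closed set, and the best of these finitely
many values wins. Any `v` is compared through a partition realising `numPieces x v`, where its
penalty is exact. -/
theorem exists_oracle {n : ℕ} (hn : 2 ≤ n) {x : Fin n → ℝ} (hx : StrictMono x)
    (μ : EuclideanSpace ℝ (Fin n)) (σ : ℝ) :
    ∃ u ∈ convexSeq x, ∀ v ∈ convexSeq x,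
      scaledNormSq (u - μ) + 16 * σ ^ 2 * (numPieces x u : ℝ) / (n : ℝ) *
          Real.log (Real.exp 1 * (n : ℝ) / (numPieces x u : ℝ)) ≤
        scaledNormSq (v - μ) + 16 * σ ^ 2 * (numPieces x v : ℝ) / (n : ℝ) *
          Real.log (Real.exp 1 * (n : ℝ) / (numPieces x v : ℝ)) := by
  choose w hwK hwQ hwmin using exists_min_affineOnParts hn hx μ
  set val : Finpartition (Finset.univ : Finset (Fin n)) → ℝ := fun Q =>
    scaledNormSq (w Q - μ) + 16 * σ ^ 2 * (Q.parts.card : ℝ) / (n : ℝ) *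
      Real.log (Real.exp 1 * (n : ℝ) / Q.parts.card) with hval
  obtain ⟨Q₀, hQ₀⟩ := Finite.exists_min val
  refine ⟨w Q₀, hwK Q₀, fun v hv => ?_⟩
  obtain ⟨Q, hQcard, hQ⟩ := (isPiecewiseAffine_numPieces x v).1
  have hle : numPieces x (w Q₀) ≤ Q₀.parts.card := Nat.sInf_le ⟨Q₀, rfl, hwQ Q₀⟩
  have hpos : 0 < numPieces x (w Q₀) := one_le_numPieces (by omega) x _
  have hQn : Q₀.parts.card ≤ n := by simpa using Q₀.card_parts_le_card
  have hpen := mul_log_div_mono (n := n) (Nat.cast_pos.2 hpos) (Nat.cast_le.2 hle)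
    (Nat.cast_le.2 hQn)
  have hc : 0 ≤ 16 * σ ^ 2 / n := by positivity
  have h1 : scaledNormSq (w Q₀ - μ) + 16 * σ ^ 2 * (numPieces x (w Q₀) : ℝ) / (n : ℝ) *
      Real.log (Real.exp 1 * (n : ℝ) / (numPieces x (w Q₀) : ℝ)) ≤ val Q₀ := by
    have := mul_le_mul_of_nonneg_left hpen hc
    simp only [hval]
    have e : ∀ k L : ℝ, 16 * σ ^ 2 * k / n * L = 16 * σ ^ 2 / n * (k * L) := fun k L => by ring
    rw [e, e]
    linarith
  refine h1.trans ((hQ₀ Q).trans ?_)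
  simp only [hval, hQcard]
  have := hwmin Q v hv hQ
  linarith

theorem mainTheorem5
    {Ω : Type*} [MeasurableSpace Ω] (P : Measure Ω) [IsProbabilityMeasure P]
    (n : ℕ) (hn : 3 ≤ n) (x : Fin n → ℝ) (hx : StrictMono x)
    (μ : EuclideanSpace ℝ (Fin n)) (σ : ℝ) (hσ : 0 < σ)
    (ξ : Ω → EuclideanSpace ℝ (Fin n))
    (hξ : HasLaw ξ (multivariateGaussian 0 (σ ^ 2 • (1 : Matrix (Fin n) (Fin n) ℝ))) P)
    (μhat : Ω → EuclideanSpace ℝ (Fin n))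
    (hμhat : ∀ ω, IsLeastSquares (convexSeq x) (μ + ξ ω) (μhat ω))
    (t : ℝ) (ht : 0 < t) :
    ∃ m : ℝ,
      IsLeast ((fun u : EuclideanSpace ℝ (Fin n) =>
          scaledNormSq (u - μ) + 16 * σ ^ 2 * (numPieces x u : ℝ) / (n : ℝ) *
            Real.log (Real.exp 1 * (n : ℝ) / (numPieces x u : ℝ))) '' convexSeq x) m ∧
      1 - Real.exp (-t) ≤
        P.real {ω | scaledNormSq (μhat ω - μ) ≤ m + 4 * σ ^ 2 * t / (n : ℝ)} := by
  obtain ⟨u, hu, hmin⟩ := exists_oracle (by omega) hx μ σ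
  refine ⟨_, ⟨⟨u, hu, rfl⟩, ?_⟩, ?_⟩
  · rintro _ ⟨v, hv, rfl⟩
    exact hmin v hv
  · obtain ⟨Q, hQcard, hQ⟩ := (isPiecewiseAffine_numPieces x u).1
    have := prob_oracle P (by omega) hx hσ hξ hμhat t hu Q hQ
    rwa [hQcard] at this
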